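/- All algebras are unital and over $\mathbb C$. For an algebra $B$, let $\iota_B\colon B\to\widehat B$ be its Arens--Michael envelope, i.e. the Hausdorff completion of $B$ with respect to the family of all submultiplicative seminorms. For a bialgebra $H$ and an $H$-module algebra $A$, let $A\# H$ be the smash product, that is, the vector space $A\otimes H$ with multiplication $(a\otimes h)(a'\otimes h')=\sum a(h_{(1)}\cdot a')\otimes h_{(2)}h'$. Let $\widetilde A$ be the $H$-completion of $A$, i.e. the Hausdorff completion with respect to all submultiplicative seminorms $\|\cdot\|$ that are $H$-stable (for each $h\in H$ there is $C>0$ with $\|h\cdot a\|\le C\|a\|$ for all $a\in A$). Let $\widetilde A\mathbin{\widehat\#}\widehat H$ be the analytic smash product: the completed projective tensor product $\widetilde A\mathbin{\widehat\otimes}\widehat H$ with the multiplication given by the same formula, where the comultiplication of $H$ and the action of $H$ on $A$ are extended by continuity to $\widehat H\to\widehat H\mathbin{\widehat\otimes}\widehat H$ and $\widehat H\mathbin{\widehat\otimes}\widetilde A\to\widetilde A$. Let $j\colon A\# H\to\widetilde A\mathbin{\widehat\#}\widehat H$, $a\otimes h\mapsto a\otimes h$, be the canonical homomorphism. Let $q\in\mathbb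 C\setminus\{0\}$, let $H=\mathbb C\mathbb Z_+$ be the semigroup bialgebra of $\mathbb Z_+=\{0,1,2,\dots\}$ with basis $(\delta_k)_{k\ge 0}$, and let $A=\mathbb C[x]$ be the $H$-module algebra with the action $(\delta_k\cdot f)(x)=f(q^{-k}x)$. Then: 1. The bialgebra $H$ is not a Hopf algebra. 2. There is an algebra isomorphism from Manin's quantum plane $\mathbb C_q[x,y]=\mathbb C\langle x,y\mid xy=qyx\rangle$ onto $A\# H$ that sends $x$ to $x\otimes 1$ and $y$ to $1\otimes\delta_1$. If moreover $|q|<1$, then: 3. The inclusion $\mathbb C[x]\to\mathbb C[[x]]$ extends to an isomorphism of topological algebras $\widetilde A\cong\mathbb C[[x]]$, where $\mathbb C[[x]]$ carries the topology of coordinatewise convergence. 4. There is an isomorphism of topological vector spaces from $\widetilde A\mathbin{\widehat\#}\widehat H$ onto the space $$\Bigl\{\sum_{i,j\ge 0} c_{ij}x^iy^j : \|c\|_{\rho,N}=\sum_{i=0}^N\sum_{j=0}^\infty|c_{ij}|\rho^j<\infty\ \ \forall\rho>0,\ N\in\mathbb Z_+\Bigr\},$$ with the topology given by the seminorms $\|\cdot\|_{\rho,N}$,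 that sends $x^i\otimes\delta_j$ to $x^iy^j$. 5. There is an isomorphism of topological vector spaces from the Arens--Michael envelope of $\mathbb C_q[x,y]$ onto the space $$\Bigl\{\sum_{i,j\ge 0} c_{ij}x^iy^j : \|c\|_{\rho}=\sum_{i,j=0}^\infty|c_{ij}||q|^{ij}\rho^{i+j}<\infty\ \ \forall\rho>0\Bigr\},$$ with the topology given by the seminorms $\|\cdot\|_\rho$, that sends $\iota(x^iy^j)$ to $x^iy^j$. 6. There is a unique continuous algebra homomorphism $\Phi\colon (A\# H)^{\widehat{\ }}\to\widetilde A\mathbin{\widehat\#}\widehat H$ with $\Phi\circ\iota_{A\# H}=j$, and $\Phi$ is not onto. 7. Consequently $j$ does not extend to an isomorphism of topological algebras $(A\# H)^{\widehat{\ }}\cong\widetilde A\mathbin{\widehat\#}\widehat H$. Thus the theorem that $j$ extends to such an isomorphism for every Hopf algebra $H$ and every $H$-module algebra $A$ cannot be generalized to arbitrary bialgebras $H$. -/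

import Mathlib

noncomputable section

namespace AMSmash

open scoped TensorProduct Topology
open Filter UniformSpace

/-! ### Locally convex spaces

A complex locally convex space is a topological vector space whose topology is generated by
seminorms. -/

/-- Locally convex spaces. -/
class LCS (E : Type*) [AddCommGroup E] [Module ℂ E] [UniformSpace E] : Prop
    extends IsUniformAddGroup E, ContinuousSMul ℂ E, PolynormableSpace ℂ E

/-- Complete Hausdorff locally convex spaces. -/
class CompleteLCS (E : Type*) [AddCommGroup E] [Module ℂ E] [UniformSpace E] : Prop
    extends LCS E, CompleteSpace E, T2Space E

/-- The vector space `E` with the locally convex topology generated by a set `S` of seminorms. -/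
def SemTop (E : Type*) [AddCommGroup E] [Module ℂ E] (_S : Set (Seminorm ℂ E)) : Type _ := E

namespace SemTop

variable {E : Type*} [AddCommGroup E] [Module ℂ E] (S : Set (Seminorm ℂ E))

instance : AddCommGroup (SemTop E S) := inferInstanceAs (AddCommGroup E)
instance : Module ℂ (SemTop E S) := inferInstanceAs (Module ℂ E)

instance : UniformSpace (SemTop E S) :=
  ⨅ p : S, (p : Seminorm ℂ E).toSeminormedAddCommGroup.toUniformSpace

instance : IsUniformAddGroup (SemTop E S) := by
  refine isUniformAddGroup_iInf fun p => ?_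
  exact @SeminormedAddCommGroup.to_isUniformAddGroup E (p : Seminorm ℂ E).toSeminormedAddCommGroup

/-- The seminorms in `S`, seen on the space that they topologise. -/
def family : SeminormFamily ℂ (SemTop E S) S := fun p => (p : Seminorm ℂ E)

theorem withSeminorms : WithSeminorms (family S) := by
  rw [SeminormFamily.withSeminorms_iff_uniformSpace_eq_iInf]
  rfl

instance : LCS (SemTop E S) where
  __ := (inferInstance : IsUniformAddGroup (SemTop E S))
  __ := (withSeminorms S).continuousSMul
  __ := (withSeminorms S).toPolynormableSpace

/-- A family of seminorms that contains `0` and is closed under maxima and under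
multiplication by constants `≥ 1`. -/
structure Saturated : Prop where
  bot_mem : (⊥ : Seminorm ℂ E) ∈ S
  sup_mem : ∀ p ∈ S, ∀ q ∈ S, p ⊔ q ∈ S
  smul_mem : ∀ p ∈ S, ∀ C : NNReal, 1 ≤ C → C • p ∈ S

theorem continuous_of_mem {p : Seminorm ℂ E} (hp : p ∈ S) :
    Continuous (fun x : SemTop E S => p x) :=
  (withSeminorms S).continuous_seminorm ⟨p, hp⟩

theorem Saturated.exists_le {S : Set (Seminorm ℂ E)} (hS : Saturated S)
    (r : Seminorm ℂ (SemTop E S)) (hr : Continuous r) : ∃ p ∈ S, ∀ x : E, r x ≤ p x := by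
  obtain ⟨s, C, -, h⟩ := Seminorm.bound_of_continuous (withSeminorms S) r hr
  have h1 : ∀ s : Finset S, ∃ p ∈ S, ∀ x : E, (s.sup (family S)) x ≤ p x := by
    intro s
    classical
    induction s using Finset.induction_on with
    | empty => exact ⟨⊥, hS.bot_mem, fun x => le_rfl⟩
    | insert a s _ ih =>
      obtain ⟨p, hp, hsp⟩ := ih
      refine ⟨a.1 ⊔ p, hS.sup_mem _ a.2 _ hp, fun x => ?_⟩
      rw [Finset.sup_insert]
      exact max_le_max le_rfl (hsp x)
  obtain ⟨p, hp, hsp⟩ := h1 s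
  refine ⟨(max C 1) • p, hS.smul_mem p hp _ (le_max_right _ _), fun x => (h x).trans ?_⟩
  change (C : ℝ) * (s.sup (family S)) x ≤ ((max C 1 : NNReal) : ℝ) * p x
  exact mul_le_mul (by exact_mod_cast le_max_left C 1) (hsp x) (apply_nonneg _ _) (by positivity)

end SemTop

instance {E : Type*} [AddCommGroup E] [Module ℂ E] [UniformSpace E] [LCS E] :
    UniformContinuousConstSMul ℂ E :=
  uniformContinuousConstSMul_of_continuousConstSMul ℂ E

section

variable {E F G : Type*} [AddCommGroup E] [Module ℂ E] [UniformSpace E] [LCS E]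
  [AddCommGroup F] [Module ℂ F] [UniformSpace F] [LCS F]
  [AddCommGroup G] [Module ℂ G] [UniformSpace G] [LCS G]

theorem exists_seminorm_of_mem_nhds {U : Set E} (hU : U ∈ 𝓝 (0 : E)) :
    ∃ p : Seminorm ℂ E, Continuous p ∧ ∀ x, p x < 1 → x ∈ U := by
  obtain ⟨⟨s, r⟩, hr, hs⟩ := (PolynormableSpace.withSeminorms ℂ E).hasBasis_zero_ball.mem_iff.1 hU
  have hr' : (0 : ℝ) < r := hr
  let c : NNReal := ⟨r⁻¹, by positivity⟩
  refine ⟨c • s.sup (fun p : {p : Seminorm ℂ E // Continuous p} ↦ p.1), ?_, fun x hx => hs ?_⟩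
  · exact (Seminorm.continuous_finsetSup fun i _ => i.2).const_smul c
  · rw [Seminorm.mem_ball_zero]
    have : r⁻¹ * (s.sup (fun p : {p : Seminorm ℂ E // Continuous p} ↦ p.1)) x < 1 := hx
    rwa [inv_mul_lt_iff₀ hr', mul_one] at this

/-- A jointly continuous bilinear map. -/
structure CBilin (E F G : Type*) [AddCommGroup E] [Module ℂ E] [UniformSpace E]
    [AddCommGroup F] [Module ℂ F] [UniformSpace F]
    [AddCommGroup G] [Module ℂ G] [UniformSpace G] where
  toBilin : E →ₗ[ℂ] F →ₗ[ℂ] G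
  cont : Continuous fun z : E × F => toBilin z.1 z.2

theorem CBilin.exists_bound (β : CBilin E F G) (r : Seminorm ℂ G) (hr : Continuous r) :
    ∃ (p : Seminorm ℂ E) (q : Seminorm ℂ F), Continuous p ∧ Continuous q ∧
      ∀ e f, r (β.toBilin e f) ≤ p e * q f := by
  have h0 : {z : E × F | r (β.toBilin z.1 z.2) < 1} ∈ 𝓝 ((0 : E), (0 : F)) := by
    apply (isOpen_lt (hr.comp β.cont) continuous_const).mem_nhds
    simp
  rw [nhds_prod_eq, mem_prod_iff] at h0
  obtain ⟨U, hU, V, hV, hUV⟩ := h0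
  obtain ⟨p, hp, hpU⟩ := exists_seminorm_of_mem_nhds hU
  obtain ⟨q, hq, hqV⟩ := exists_seminorm_of_mem_nhds hV
  refine ⟨p, q, hp, hq, fun e f => ?_⟩
  have key : ∀ ε : ℝ, 0 < ε → r (β.toBilin e f) ≤ (p e + ε) * (q f + ε) := by
    intro ε hε
    have h1 : 0 < p e + ε := add_pos_of_nonneg_of_pos (apply_nonneg p e) hε
    have h2 : 0 < q f + ε := add_pos_of_nonneg_of_pos (apply_nonneg q f) hε
    have := @hUV ((((p e + ε)⁻¹ : ℝ) : ℂ) • e, (((q f + ε)⁻¹ : ℝ) : ℂ) • f) ⟨hpU _ ?_, hqV _ ?_⟩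
    · simp only [Set.mem_ofPred_eq, map_smul, LinearMap.smul_apply, map_smul_eq_mul,
        Complex.norm_real, norm_inv, Real.norm_of_nonneg h1.le, Real.norm_of_nonneg h2.le] at this
      rw [inv_mul_lt_iff₀ h2, inv_mul_lt_iff₀ h1] at this
      linarith
    · simp only [map_smul_eq_mul, Complex.norm_real, norm_inv, Real.norm_of_nonneg h1.le]
      rw [inv_mul_lt_iff₀ h1]; linarith
    · simp only [map_smul_eq_mul, Complex.norm_real, norm_inv, Real.norm_of_nonneg h2.le]
      rw [inv_mul_lt_iff₀ h2]; linarith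
  have ht : Tendsto (fun ε : ℝ => (p e + ε) * (q f + ε)) (𝓝[>] 0) (𝓝 (p e * q f)) := by
    have : Continuous (fun ε : ℝ => (p e + ε) * (q f + ε)) := by fun_prop
    have := this.tendsto 0
    simp only [add_zero] at this
    exact this.mono_left nhdsWithin_le_nhds
  exact ge_of_tendsto ht (eventually_mem_nhdsWithin.mono fun ε hε => key ε hε)

/-- A bilinear map that is bounded in every continuous seminorm is jointly continuous. -/
theorem continuous_of_bound (β : E →ₗ[ℂ] F →ₗ[ℂ] G)
    (h : ∀ r : Seminorm ℂ G, Continuous r → ∃ (p : Seminorm ℂ E) (q : Seminorm ℂ F),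
      Continuous p ∧ Continuous q ∧ ∀ e f, r (β e f) ≤ p e * q f) :
    Continuous fun z : E × F => β z.1 z.2 := by
  rw [continuous_iff_continuousAt]
  rintro ⟨e₀, f₀⟩
  refine ((PolynormableSpace.withSeminorms ℂ G).tendsto_nhds' _ _).2 fun s ε hε => ?_
  set r : Seminorm ℂ G := s.sup (fun p : {p : Seminorm ℂ G // Continuous p} ↦ p.1)
  have hs : Continuous r := Seminorm.continuous_finsetSup fun i _ => i.2
  obtain ⟨p, q, hp, hq, hpq⟩ := h r hs
  have hb : ∀ z : E × F, r (β z.1 z.2 - β e₀ f₀) ≤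
      p (z.1 - e₀) * q (z.2 - f₀) + p e₀ * q (z.2 - f₀) + p (z.1 - e₀) * q f₀ := by
    intro z
    have : β z.1 z.2 - β e₀ f₀ =
        β (z.1 - e₀) (z.2 - f₀) + β e₀ (z.2 - f₀) + β (z.1 - e₀) f₀ := by
      simp only [map_sub, LinearMap.sub_apply]; abel
    rw [this]
    refine (map_add_le_add r _ _).trans (add_le_add ((map_add_le_add r _ _).trans
      (add_le_add (hpq _ _) (hpq _ _))) (hpq _ _))
  have hc : Continuous fun z : E × F =>
      p (z.1 - e₀) * q (z.2 - f₀) + p e₀ * q (z.2 - f₀) + p (z.1 - e₀) * q f₀ := by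
    have h1 : Continuous fun z : E × F => p (z.1 - e₀) := hp.comp (by fun_prop)
    have h2 : Continuous fun z : E × F => q (z.2 - f₀) := hq.comp (by fun_prop)
    fun_prop
  have := hc.tendsto (e₀, f₀)
  simp only [sub_self, map_zero, mul_zero, zero_mul, add_zero] at this
  filter_upwards [this.eventually (gt_mem_nhds hε)] with z hz
  exact (hb z).trans_lt hz

/-- The continuous extension of a continuous seminorm to the completion. -/
def completionSeminorm (p : Seminorm ℂ E) (hp : Continuous p) : Seminorm ℂ (Completion E) :=
  have hu : UniformContinuous p := Seminorm.uniformContinuous_of_continuousAt_zero hp.continuousAt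
  have hc : Continuous (Completion.extension p) := Completion.continuous_extension
  Seminorm.of (Completion.extension p)
    (fun x y => by
      induction x, y using Completion.induction_on₂ with
      | hp => exact isClosed_le (by fun_prop) (by fun_prop)
      | ih x y =>
        rw [← Completion.coe_add]
        simp only [Completion.extension_coe hu]
        exact map_add_le_add p x y)
    (fun c x => by
      induction x using Completion.induction_on with
      | hp => exact isClosed_eq (hc.comp (continuous_const_smul c)) (by fun_prop)
      | ih x =>
        rw [← Completion.coe_smul]
        simp only [Completion.extension_coe hu]
        exact map_smul_eq_mul p c x)

theorem completionSeminorm_coe (p : Seminorm ℂ E) (hp : Continuous p) (x : E) :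
    completionSeminorm p hp (x : Completion E) = p x :=
  Completion.extension_coe (Seminorm.uniformContinuous_of_continuousAt_zero hp.continuousAt) x

theorem continuous_completionSeminorm (p : Seminorm ℂ E) (hp : Continuous p) :
    Continuous (completionSeminorm p hp) :=
  Completion.continuous_extension (f := p)

theorem completion_withSeminorms :
    WithSeminorms (fun p : {p : Seminorm ℂ E // Continuous p} => completionSeminorm p.1 p.2) := by
  rw [SeminormFamily.withSeminorms_iff_nhds_eq_iInf]
  refine le_antisymm (le_iInf fun p => ?_) fun U hU => ?_
  · rw [← map_le_iff_le_comap]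
    have := (continuous_completionSeminorm p.1 p.2).tendsto 0
    rwa [map_zero] at this
  · obtain ⟨V, hV, hVc, hVU⟩ := exists_mem_nhds_isClosed_subset hU
    have h1 : (fun x : E => (x : Completion E)) ⁻¹' V ∈ 𝓝 (0 : E) := by
      apply (Completion.continuous_coe E).continuousAt.preimage_mem_nhds
      rwa [Completion.coe_zero]
    obtain ⟨p, hp, hpV⟩ := exists_seminorm_of_mem_nhds h1
    refine mem_iInf_of_mem ⟨p, hp⟩ ⟨Set.Iio 1, Iio_mem_nhds zero_lt_one, fun x hx => hVU ?_⟩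
    have ho : IsOpen {x | completionSeminorm p hp x < 1} :=
      isOpen_lt (continuous_completionSeminorm p hp) continuous_const
    have hd := (Completion.denseRange_coe (α := E)).open_subset_closure_inter ho hx
    refine hVc.closure_subset_iff.2 ?_ hd
    rintro _ ⟨hy, y, rfl⟩
    refine hpV y ?_
    have : completionSeminorm p hp (y : Completion E) < 1 := hy
    rwa [completionSeminorm_coe] at this

instance : CompleteLCS (Completion E) where
  __ := (inferInstance : IsUniformAddGroup (Completion E))
  __ := (completion_withSeminorms (E := E)).continuousSMul
  __ := (completion_withSeminorms (E := E)).toPolynormableSpace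
  __ := (inferInstance : CompleteSpace (Completion E))
  __ := (inferInstance : T2Space (Completion E))

/-- The canonical map of a locally convex space to its Hausdorff completion. -/
def toCompl (E : Type*) [AddCommGroup E] [Module ℂ E] [UniformSpace E] [LCS E] :
    E →L[ℂ] Completion E where
  toFun x := x
  map_add' x y := Completion.coe_add x y
  map_smul' c x := Completion.coe_smul c x
  cont := Completion.continuous_coe E

theorem isUniformInducing_toCompl : IsUniformInducing (toCompl E) :=
  Completion.isUniformInducing_coe E

theorem denseRange_toCompl : DenseRange (toCompl E) := Completion.denseRange_coe

theorem isDenseInducing_toCompl : IsDenseInducing (toCompl E) :=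
  isUniformInducing_toCompl.isDenseInducing denseRange_toCompl

end

section Extend

variable {E F G E' F' : Type*} [AddCommGroup E] [Module ℂ E] [UniformSpace E] [LCS E]
  [AddCommGroup F] [Module ℂ F] [UniformSpace F] [LCS F]
  [AddCommGroup G] [Module ℂ G] [UniformSpace G] [CompleteLCS G]
  [AddCommGroup E'] [Module ℂ E'] [UniformSpace E'] [LCS E']
  [AddCommGroup F'] [Module ℂ F'] [UniformSpace F'] [LCS F']

/-- Extension by continuity of a jointly continuous bilinear map. -/
def CBilin.extend (β : CBilin E F G) (i : E →L[ℂ] E') (j : F →L[ℂ] F')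
    (hi : IsDenseInducing i) (hj : IsDenseInducing j) : CBilin E' F' G :=
  let ψ : E' × F' → G := (hi.prodMap hj).extend fun z : E × F => β.toBilin z.1 z.2
  have hψ : Continuous ψ :=
    IsDenseInducing.extend_Z_bilin (e := (i : E →+ E')) (f := (j : F →+ F')) hi hj
      (φ := (LinearMap.toAddMonoidHom'.comp β.toBilin.toAddMonoidHom)) β.cont
  have he : ∀ e f, ψ (i e, j f) = β.toBilin e f := fun e f =>
    (hi.prodMap hj).extend_eq β.cont (e, f)
  { toBilin := LinearMap.mk₂ ℂ (fun e f => ψ (e, f))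
      (fun x y f => congr_fun ((hi.dense.prodMap (hi.dense.prodMap hj.dense)).equalizer
          (g := fun z : E' × E' × F' => ψ (z.1 + z.2.1, z.2.2))
          (h := fun z : E' × E' × F' => ψ (z.1, z.2.2) + ψ (z.2.1, z.2.2))
          (by fun_prop) (by fun_prop) (funext fun z => by
            change ψ (i z.1 + i z.2.1, j z.2.2) = ψ (i z.1, j z.2.2) + ψ (i z.2.1, j z.2.2)
            rw [← map_add i, he, he, he, map_add, LinearMap.add_apply])) (x, y, f))
      (fun c x f => congr_fun ((hi.dense.prodMap hj.dense).equalizer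
          (g := fun z : E' × F' => ψ (c • z.1, z.2)) (h := fun z : E' × F' => c • ψ z)
          (by fun_prop) (by fun_prop) (funext fun z => by
            change ψ (c • i z.1, j z.2) = c • ψ (i z.1, j z.2)
            rw [← map_smul i, he, he, map_smul, LinearMap.smul_apply])) (x, f))
      (fun x f g => congr_fun ((hi.dense.prodMap (hj.dense.prodMap hj.dense)).equalizer
          (g := fun z : E' × F' × F' => ψ (z.1, z.2.1 + z.2.2))
          (h := fun z : E' × F' × F' => ψ (z.1, z.2.1) + ψ (z.1, z.2.2))
          (by fun_prop) (by fun_prop) (funext fun z => by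
            change ψ (i z.1, j z.2.1 + j z.2.2) = ψ (i z.1, j z.2.1) + ψ (i z.1, j z.2.2)
            rw [← map_add j, he, he, he, map_add])) (x, f, g))
      (fun c x f => congr_fun ((hi.dense.prodMap hj.dense).equalizer
          (g := fun z : E' × F' => ψ (z.1, c • z.2)) (h := fun z : E' × F' => c • ψ z)
          (by fun_prop) (by fun_prop) (funext fun z => by
            change ψ (i z.1, c • j z.2) = c • ψ (i z.1, j z.2)
            rw [← map_smul j, he, he, map_smul])) (x, f))
    cont := hψ }

theorem CBilin.extend_apply (β : CBilin E F G) (i : E →L[ℂ] E') (j : F →L[ℂ] F')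
    (hi : IsDenseInducing i) (hj : IsDenseInducing j) (e : E) (f : F) :
    (β.extend i j hi hj).toBilin (i e) (j f) = β.toBilin e f :=
  (hi.prodMap hj).extend_eq β.cont (e, f)

end Extend

/-! ### The completed projective tensor product -/

section Proj

/-- The projective topology on `E ⊗ F` is generated by the seminorms for which the canonical
bilinear map `E × F → E ⊗ F` is jointly continuous. -/
def projSeminorms (E F : Type*) [AddCommGroup E] [Module ℂ E] [TopologicalSpace E]
    [AddCommGroup F] [Module ℂ F] [TopologicalSpace F] : Set (Seminorm ℂ (E ⊗[ℂ] F)) :=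
  {r | ∃ (p : Seminorm ℂ E) (q : Seminorm ℂ F), Continuous p ∧ Continuous q ∧
    ∀ e f, r (e ⊗ₜ f) ≤ p e * q f}

theorem projSeminorms_saturated (E F : Type*) [AddCommGroup E] [Module ℂ E] [UniformSpace E] [LCS E]
    [AddCommGroup F] [Module ℂ F] [UniformSpace F] [LCS F] :
    SemTop.Saturated (projSeminorms E F) where
  bot_mem := ⟨⊥, ⊥, continuous_const, continuous_const, fun e f => by simp⟩
  sup_mem := by
    rintro r ⟨p, q, hp, hq, h⟩ r' ⟨p', q', hp', hq', h'⟩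
    refine ⟨p ⊔ p', q ⊔ q', hp.sup hp', hq.sup hq', fun e f => ?_⟩
    simp only [Seminorm.sup_apply]
    exact max_le
      ((h e f).trans (mul_le_mul (le_max_left _ _) (le_max_left _ _) (by simp) (by simp)))
      ((h' e f).trans (mul_le_mul (le_max_right _ _) (le_max_right _ _) (by simp) (by simp)))
  smul_mem := by
    rintro r ⟨p, q, hp, hq, h⟩ C -
    refine ⟨C • p, q, hp.const_smul C, hq, fun e f => ?_⟩
    simp only [smul_apply, NNReal.smul_def, smul_eq_mul, mul_assoc]
    exact mul_le_mul_of_nonneg_left (h e f) C.2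

/-- The completed projective tensor product `E ⊗̂ F`. -/
def CTP (E F : Type*) [AddCommGroup E] [Module ℂ E] [TopologicalSpace E]
    [AddCommGroup F] [Module ℂ F] [TopologicalSpace F] : Type _ :=
  Completion (SemTop (E ⊗[ℂ] F) (projSeminorms E F))

namespace CTP

section basic
variable (E F : Type*) [AddCommGroup E] [Module ℂ E] [TopologicalSpace E]
  [AddCommGroup F] [Module ℂ F] [TopologicalSpace F]

instance : AddCommGroup (CTP E F) :=
  inferInstanceAs (AddCommGroup (Completion (SemTop (E ⊗[ℂ] F) (projSeminorms E F))))
instance : Module ℂ (CTP E F) :=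
  inferInstanceAs (Module ℂ (Completion (SemTop (E ⊗[ℂ] F) (projSeminorms E F))))
instance : UniformSpace (CTP E F) :=
  inferInstanceAs (UniformSpace (Completion (SemTop (E ⊗[ℂ] F) (projSeminorms E F))))
instance : CompleteLCS (CTP E F) :=
  inferInstanceAs (CompleteLCS (Completion (SemTop (E ⊗[ℂ] F) (projSeminorms E F))))

/-- The canonical map from `E ⊗ F` (with the projective topology) to `E ⊗̂ F`. -/
def ofSemTop : SemTop (E ⊗[ℂ] F) (projSeminorms E F) →L[ℂ] CTP E F := toCompl _

/-- The canonical linear map `E ⊗ F → E ⊗̂ F`. -/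
def ofTensor : E ⊗[ℂ] F →ₗ[ℂ] CTP E F :=
  ((ofSemTop E F : SemTop (E ⊗[ℂ] F) (projSeminorms E F) →ₗ[ℂ] CTP E F) :)

theorem denseRange_ofTensor : DenseRange (ofTensor E F) :=
  denseRange_toCompl (E := SemTop (E ⊗[ℂ] F) (projSeminorms E F))

end basic

variable {E F G K : Type*} [AddCommGroup E] [Module ℂ E] [UniformSpace E] [LCS E]
  [AddCommGroup F] [Module ℂ F] [UniformSpace F] [LCS F]
  [AddCommGroup G] [Module ℂ G] [UniformSpace G] [LCS G]
  [AddCommGroup K] [Module ℂ K] [UniformSpace K] [CompleteLCS K]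

/-- The canonical bilinear map `E × F → E ⊗̂ F`. -/
def tmul (E F : Type*) [AddCommGroup E] [Module ℂ E] [UniformSpace E] [LCS E]
    [AddCommGroup F] [Module ℂ F] [UniformSpace F] [LCS F] : CBilin E F (CTP E F) where
  toBilin := (TensorProduct.mk ℂ E F).compr₂ (ofTensor E F)
  cont := by
    refine continuous_of_bound _ fun r hr => ?_
    obtain ⟨r', ⟨p, q, hp, hq, h⟩, hr'⟩ := (projSeminorms_saturated E F).exists_le
      (r.comp (ofSemTop E F : SemTop (E ⊗[ℂ] F) (projSeminorms E F) →ₗ[ℂ] CTP E F))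
      (hr.comp (ofSemTop E F).continuous)
    exact ⟨p, q, hp, hq, fun e f => (hr' (e ⊗ₜ f)).trans (h e f)⟩

theorem continuous_tensorLift (β : CBilin E F G) :
    Continuous (fun t : SemTop (E ⊗[ℂ] F) (projSeminorms E F) =>
      (TensorProduct.lift β.toBilin : E ⊗[ℂ] F →ₗ[ℂ] G) t) := by
  refine WithSeminorms.continuous_of_continuous_comp (PolynormableSpace.withSeminorms ℂ G)
    (show SemTop (E ⊗[ℂ] F) (projSeminorms E F) →ₗ[ℂ] G from TensorProduct.lift β.toBilin)
    fun r => ?_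
  obtain ⟨p, q, hp, hq, h⟩ := β.exists_bound r.1 r.2
  exact SemTop.continuous_of_mem (projSeminorms E F)
    (p := r.1.comp (TensorProduct.lift β.toBilin)) ⟨p, q, hp, hq, fun e f => by simpa using h e f⟩

/-- The continuous linear map on `E ⊗̂ F` given by a jointly continuous bilinear map. -/
def lift (β : CBilin E F K) : CTP E F →L[ℂ] K :=
  ContinuousLinearMap.extend
    (⟨(show SemTop (E ⊗[ℂ] F) (projSeminorms E F) →ₗ[ℂ] K from TensorProduct.lift β.toBilin),
      continuous_tensorLift β⟩ : SemTop (E ⊗[ℂ] F) (projSeminorms E F) →L[ℂ] K)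
    (ofSemTop E F)

theorem lift_ofTensor (β : CBilin E F K) (t : E ⊗[ℂ] F) :
    lift β (ofTensor E F t) = TensorProduct.lift β.toBilin t :=
  ContinuousLinearMap.extend_eq _ denseRange_toCompl isUniformInducing_toCompl _

end CTP
end Proj

section ProjSeminorm

variable {E F : Type*} [AddCommGroup E] [Module ℂ E] [AddCommGroup F] [Module ℂ F]

/-- The projective tensor product of two seminorms: the largest seminorm `r` on `E ⊗ F` with
`r (e ⊗ f) ≤ p e * q f`. -/
def projSeminorm (p : Seminorm ℂ E) (q : Seminorm ℂ F) : Seminorm ℂ (E ⊗[ℂ] F) :=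
  sSup {r | ∀ e f, r (e ⊗ₜ f) ≤ p e * q f}

theorem bddAbove_projSeminorm (p : Seminorm ℂ E) (q : Seminorm ℂ F) :
    BddAbove {r : Seminorm ℂ (E ⊗[ℂ] F) | ∀ e f, r (e ⊗ₜ f) ≤ p e * q f} := by
  rw [Seminorm.bddAbove_iff]
  have : ∀ t : E ⊗[ℂ] F, ∃ M : ℝ, ∀ r : Seminorm ℂ (E ⊗[ℂ] F),
      (∀ e f, r (e ⊗ₜ f) ≤ p e * q f) → r t ≤ M := by
    intro t
    induction t using TensorProduct.induction_on with
    | zero => exact ⟨0, fun r _ => by simp⟩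
    | tmul e f => exact ⟨_, fun r hr => hr e f⟩
    | add x y hx hy =>
      obtain ⟨M, hM⟩ := hx
      obtain ⟨N, hN⟩ := hy
      exact ⟨M + N, fun r hr => (map_add_le_add r x y).trans (add_le_add (hM r hr) (hN r hr))⟩
  choose M hM using this
  refine ⟨M, ?_⟩
  rintro _ ⟨r, hr, rfl⟩ t
  exact hM t r hr

theorem projSeminorm_tmul_le (p : Seminorm ℂ E) (q : Seminorm ℂ F) (e : E) (f : F) :
    projSeminorm p q (e ⊗ₜ f) ≤ p e * q f := by
  rw [projSeminorm, Seminorm.sSup_apply (bddAbove_projSeminorm p q)]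
  refine Real.iSup_le (fun r => r.2 e f) (mul_nonneg (apply_nonneg _ _) (apply_nonneg _ _))

theorem le_projSeminorm {p : Seminorm ℂ E} {q : Seminorm ℂ F} {r : Seminorm ℂ (E ⊗[ℂ] F)} {C : ℝ}
    (hC : 0 ≤ C) (h : ∀ e f, r (e ⊗ₜ f) ≤ C * (p e * q f)) (t : E ⊗[ℂ] F) :
    r t ≤ C * projSeminorm p q t := by
  rcases hC.eq_or_lt with rfl | hC
  · have : r t ≤ 0 := by
      induction t using TensorProduct.induction_on with
      | zero => simp
      | tmul e f => simpa using h e f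
      | add x y hx hy => exact (map_add_le_add r x y).trans (by linarith)
    simpa using this
  · have h1 : (Real.toNNReal C⁻¹) • r ≤ projSeminorm p q := by
      refine le_csSup (bddAbove_projSeminorm p q) fun e f => ?_
      change ((Real.toNNReal C⁻¹ : NNReal) : ℝ) * r (e ⊗ₜ f) ≤ _
      rw [Real.coe_toNNReal _ (by positivity)]
      rw [inv_mul_le_iff₀ hC]
      exact h e f
    have h2 : ((Real.toNNReal C⁻¹ : NNReal) : ℝ) * r t ≤ projSeminorm p q t := h1 t
    rw [Real.coe_toNNReal _ (by positivity)] at h2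
    rwa [inv_mul_le_iff₀ hC] at h2

end ProjSeminorm

namespace CTP

variable {E F G K E' F' : Type*} [AddCommGroup E] [Module ℂ E] [UniformSpace E] [LCS E]
  [AddCommGroup F] [Module ℂ F] [UniformSpace F] [LCS F]
  [AddCommGroup G] [Module ℂ G] [UniformSpace G] [LCS G]
  [AddCommGroup K] [Module ℂ K] [UniformSpace K] [CompleteLCS K]
  [AddCommGroup E'] [Module ℂ E'] [UniformSpace E'] [LCS E']
  [AddCommGroup F'] [Module ℂ F'] [UniformSpace F'] [LCS F']

/-- The elementary tensor `e ⊗ f` in `E ⊗̂ F`. -/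
def mk (e : E) (f : F) : CTP E F := (tmul E F).toBilin e f

theorem add_mk (e e' : E) (f : F) : mk (e + e') f = mk e f + mk e' f := by simp [mk]

theorem mk_add (e : E) (f f' : F) : mk e (f + f') = mk e f + mk e f' := by simp [mk]

theorem zero_mk (f : F) : mk (0 : E) f = 0 := by simp [mk]

theorem mk_zero (e : E) : mk e (0 : F) = 0 := by simp [mk]

theorem smul_mk (c : ℂ) (e : E) (f : F) : mk (c • e) f = c • mk e f := by simp [mk]

theorem mk_smul (c : ℂ) (e : E) (f : F) : mk e (c • f) = c • mk e f := by simp [mk]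

theorem ofTensor_tmul (e : E) (f : F) : ofTensor E F (e ⊗ₜ f) = mk e f := rfl

theorem lift_mk (β : CBilin E F K) (e : E) (f : F) : lift β (mk e f) = β.toBilin e f := by
  rw [← ofTensor_tmul, lift_ofTensor, TensorProduct.lift.tmul]

/-- The continuous linear map `f ⊗̂ g`. -/
def map (f : E →L[ℂ] E') (g : F →L[ℂ] F') : CTP E F →L[ℂ] CTP E' F' :=
  lift ⟨(tmul E' F').toBilin.compl₁₂ f.toLinearMap g.toLinearMap,
    (tmul E' F').cont.comp (f.continuous.prodMap g.continuous)⟩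

theorem map_mk (f : E →L[ℂ] E') (g : F →L[ℂ] F') (e : E) (x : F) :
    map f g (mk e x) = mk (f e) (g x) := lift_mk _ _ _

/-- The flip `E ⊗̂ F → F ⊗̂ E`. -/
def comm (E F : Type*) [AddCommGroup E] [Module ℂ E] [UniformSpace E] [LCS E]
    [AddCommGroup F] [Module ℂ F] [UniformSpace F] [LCS F] : CTP E F →L[ℂ] CTP F E :=
  lift ⟨(tmul F E).toBilin.flip, (tmul F E).cont.comp continuous_swap⟩

theorem comm_mk (e : E) (f : F) : comm E F (mk e f) = mk f e := lift_mk _ _ _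

/-- The map `(E ⊗ F) × G → E ⊗̂ (F ⊗̂ G)`, `(e ⊗ f, g) ↦ e ⊗ (f ⊗ g)`. -/
def assocAux (E F G : Type*) [AddCommGroup E] [Module ℂ E] [UniformSpace E] [LCS E]
    [AddCommGroup F] [Module ℂ F] [UniformSpace F] [LCS F]
    [AddCommGroup G] [Module ℂ G] [UniformSpace G] [LCS G] :
    E ⊗[ℂ] F →ₗ[ℂ] G →ₗ[ℂ] CTP E (CTP F G) :=
  TensorProduct.lift <| LinearMap.mk₂ ℂ
    (fun e f => (tmul E (CTP F G)).toBilin e ∘ₗ (tmul F G).toBilin f)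
    (fun _ _ _ => by ext; simp) (fun _ _ _ => by ext; simp)
    (fun _ _ _ => by ext; simp) (fun _ _ _ => by ext; simp)

/-- The associativity map `(E ⊗̂ F) ⊗̂ G → E ⊗̂ (F ⊗̂ G)`. -/
def assoc (E F G : Type*) [AddCommGroup E] [Module ℂ E] [UniformSpace E] [LCS E]
    [AddCommGroup F] [Module ℂ F] [UniformSpace F] [LCS F]
    [AddCommGroup G] [Module ℂ G] [UniformSpace G] [LCS G] :
    CTP (CTP E F) G →L[ℂ] CTP E (CTP F G) :=
  lift <| CBilin.extend
    (⟨(show SemTop (E ⊗[ℂ] F) (projSeminorms E F) →ₗ[ℂ] G →ₗ[ℂ] CTP E (CTP F G) from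
        assocAux E F G), by
      refine continuous_of_bound _ fun r hr => ?_
      obtain ⟨p, q, hp, hq, h⟩ := (tmul E (CTP F G)).exists_bound r hr
      obtain ⟨p', q', hp', hq', h'⟩ := (tmul F G).exists_bound q hq
      refine ⟨projSeminorm p p', q', ?_, hq', fun t g => ?_⟩
      · exact SemTop.continuous_of_mem (projSeminorms E F)
          ⟨p, p', hp, hp', projSeminorm_tmul_le p p'⟩
      · rw [mul_comm]
        refine le_projSeminorm (r := r.comp ((assocAux E F G).flip g)) (apply_nonneg q' g)
          (fun e f => ?_) t
        calc r (mk e (mk f g)) ≤ p e * q (mk f g) := h _ _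
          _ ≤ p e * (p' f * q' g) := by gcongr; exact h' _ _
          _ = q' g * (p e * p' f) := by ring⟩ :
      CBilin (SemTop (E ⊗[ℂ] F) (projSeminorms E F)) G (CTP E (CTP F G)))
    (ofSemTop E F) (ContinuousLinearMap.id ℂ G)
    (isDenseInducing_toCompl (E := SemTop (E ⊗[ℂ] F) (projSeminorms E F)))
    ⟨.id, denseRange_id⟩

theorem assoc_mk (e : E) (f : F) (g : G) :
    assoc E F G (mk (mk e f) g) = mk e (mk f g) := by
  rw [assoc, lift_mk]
  exact CBilin.extend_apply _ _ _ _ _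
    (show SemTop (E ⊗[ℂ] F) (projSeminorms E F) from e ⊗ₜ[ℂ] f) g

/-- The inverse associativity map `E ⊗̂ (F ⊗̂ G) → (E ⊗̂ F) ⊗̂ G`. -/
def assocSymm (E F G : Type*) [AddCommGroup E] [Module ℂ E] [UniformSpace E] [LCS E]
    [AddCommGroup F] [Module ℂ F] [UniformSpace F] [LCS F]
    [AddCommGroup G] [Module ℂ G] [UniformSpace G] [LCS G] :
    CTP E (CTP F G) →L[ℂ] CTP (CTP E F) G :=
  (comm G (CTP E F)) ∘L (map (ContinuousLinearMap.id ℂ G) (comm F E)) ∘L (assoc G F E) ∘L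
    (map (comm F G) (ContinuousLinearMap.id ℂ E)) ∘L (comm E (CTP F G))

theorem assocSymm_mk (e : E) (f : F) (g : G) :
    assocSymm E F G (mk e (mk f g)) = mk (mk e f) g := by
  simp only [assocSymm, ContinuousLinearMap.comp_apply, comm_mk, map_mk, assoc_mk,
    ContinuousLinearMap.id_apply]

end CTP

/-! ### Arens-Michael envelopes -/

section Submul

/-- The submultiplicative seminorms on an algebra. -/
def submulSeminorms (A : Type*) [Ring A] [Algebra ℂ A] : Set (Seminorm ℂ A) :=
  {p | ∀ a b, p (a * b) ≤ p a * p b}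

/-- A saturated family of submultiplicative seminorms. -/
class SubmulFamily {A : Type*} [Ring A] [Algebra ℂ A] (S : Set (Seminorm ℂ A)) : Prop where
  subset : S ⊆ submulSeminorms A
  saturated : SemTop.Saturated S

variable {A : Type*} [Ring A] [Algebra ℂ A]

instance (S : Set (Seminorm ℂ A)) : Ring (SemTop A S) := inferInstanceAs (Ring A)
instance (S : Set (Seminorm ℂ A)) : Algebra ℂ (SemTop A S) := inferInstanceAs (Algebra ℂ A)

instance (S : Set (Seminorm ℂ A)) [hS : SubmulFamily S] : IsTopologicalRing (SemTop A S) where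
  continuous_mul := by
    refine continuous_of_bound (LinearMap.mul ℂ (SemTop A S)) fun r hr => ?_
    obtain ⟨p, hp, hrp⟩ := hS.saturated.exists_le r hr
    exact ⟨p, p, SemTop.continuous_of_mem S hp, SemTop.continuous_of_mem S hp,
      fun a b => (hrp _).trans (hS.subset hp a b)⟩
  continuous_neg := continuous_neg

theorem submul_sup {p q : Seminorm ℂ A} (hp : p ∈ submulSeminorms A)
    (hq : q ∈ submulSeminorms A) : p ⊔ q ∈ submulSeminorms A := fun a b => by
  simp only [Seminorm.sup_apply]
  exact max_le
    ((hp a b).trans (mul_le_mul (le_max_left _ _) (le_max_left _ _) (by simp) (by simp)))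
    ((hq a b).trans (mul_le_mul (le_max_right _ _) (le_max_right _ _) (by simp) (by simp)))

theorem submul_smul {p : Seminorm ℂ A} (hp : p ∈ submulSeminorms A) {C : NNReal} (hC : 1 ≤ C) :
    C • p ∈ submulSeminorms A := fun a b => by
  simp only [smul_apply, NNReal.smul_def, smul_eq_mul]
  have h1 : (1 : ℝ) ≤ C := by exact_mod_cast hC
  have h2 : 0 ≤ p a * p b := mul_nonneg (apply_nonneg _ _) (apply_nonneg _ _)
  have h3 := hp a b
  calc (C : ℝ) * p (a * b) ≤ C * (p a * p b) := by gcongr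
    _ ≤ C * (C * (p a * p b)) := 
      mul_le_mul_of_nonneg_left (le_mul_of_one_le_left h2 h1) C.2
    _ = _ := by ring

instance : SubmulFamily (submulSeminorms A) where
  subset := subset_rfl
  saturated :=
    { bot_mem := fun a b => by simp
      sup_mem := fun _ hp _ hq => submul_sup hp hq
      smul_mem := fun _ hp _ hC => submul_smul hp hC }

/-- The algebra `A` with the topology given by all submultiplicative seminorms. -/
abbrev AMTop (A : Type*) [Ring A] [Algebra ℂ A] : Type _ := SemTop A (submulSeminorms A)

/-- The Arens-Michael envelope of an algebra `A`: the Hausdorff completion of `A` with respect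
to the family of all submultiplicative seminorms. -/
abbrev AMEnvelope (A : Type*) [Ring A] [Algebra ℂ A] : Type _ := Completion (AMTop A)

/-- The canonical homomorphism from an algebra to its Arens-Michael envelope. -/
def toAMEnvelope (A : Type*) [Ring A] [Algebra ℂ A] : A →ₐ[ℂ] AMEnvelope A where
  toFun a := ((show AMTop A from a) : AMEnvelope A)
  map_one' := Completion.coe_one _
  map_mul' a b := Completion.coe_mul (α := AMTop A) a b
  map_zero' := Completion.coe_zero
  map_add' a b := Completion.coe_add (α := AMTop A) a b
  commutes' _ := rfl

end Submul

/-! ### Module algebras and smash products -/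

section Smash

open Coalgebra

/-- An `H`-module algebra structure on `A`: an action of the algebra `H` on the vector space `A`
for which the unit `ℂ → A` and the product `A ⊗ A → A` are morphisms of `H`-modules. -/
structure ModuleAlgebra (H A : Type*) [Ring H] [Bialgebra ℂ H] [Ring A] [Algebra ℂ A] where
  act : H →ₐ[ℂ] Module.End ℂ A
  act_one : ∀ h : H, act h 1 = counit (R := ℂ) h • (1 : A)
  act_mul : ∀ (h : H) (a b : A), act h (a * b) = LinearMap.mul' ℂ A
    (TensorProduct.map (act.toLinearMap.flip a) (act.toLinearMap.flip b) (comul (R := ℂ) h))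

variable {H A : Type*} [Ring H] [Bialgebra ℂ H] [Ring A] [Algebra ℂ A]

namespace ModuleAlgebra

variable (ρ : ModuleAlgebra H A)

/-- The action as a map `H ⊗ A → A`. -/
def actionMap : H ⊗[ℂ] A →ₗ[ℂ] A := TensorProduct.lift ρ.act.toLinearMap

/-- The map `τ : H ⊗ A → A ⊗ H`, `τ (h ⊗ a) = ∑ h₍₁₎ • a ⊗ h₍₂₎`. -/
def tau : H ⊗[ℂ] A →ₗ[ℂ] A ⊗[ℂ] H :=
  TensorProduct.map ρ.actionMap LinearMap.id ∘ₗ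
  (TensorProduct.assoc ℂ H A H).symm.toLinearMap ∘ₗ
  TensorProduct.map LinearMap.id (TensorProduct.comm ℂ H A).toLinearMap ∘ₗ
  (TensorProduct.assoc ℂ H H A).toLinearMap ∘ₗ
  TensorProduct.map (comul (R := ℂ) (A := H)) LinearMap.id

/-- The multiplication of the smash product. -/
def smashMul : (A ⊗[ℂ] H) ⊗[ℂ] (A ⊗[ℂ] H) →ₗ[ℂ] A ⊗[ℂ] H :=
  TensorProduct.map (LinearMap.mul' ℂ A) (LinearMap.mul' ℂ H) ∘ₗ
  (TensorProduct.assoc ℂ A A (H ⊗[ℂ] H)).symm.toLinearMap ∘ₗ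
  TensorProduct.map LinearMap.id (TensorProduct.assoc ℂ A H H).toLinearMap ∘ₗ
  TensorProduct.map LinearMap.id (TensorProduct.map ρ.tau LinearMap.id) ∘ₗ
  TensorProduct.map LinearMap.id (TensorProduct.assoc ℂ H A H).symm.toLinearMap ∘ₗ
  (TensorProduct.assoc ℂ A H (A ⊗[ℂ] H)).toLinearMap

theorem tau_tmul (h : H) (a : A) :
    ρ.tau (h ⊗ₜ a) =
      TensorProduct.map (ρ.act.toLinearMap.flip a) LinearMap.id (comul (R := ℂ) h) := by
  simp only [tau, LinearMap.comp_apply, TensorProduct.map_tmul, LinearMap.id_apply]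
  induction comul (R := ℂ) h using TensorProduct.induction_on with
  | zero => simp
  | tmul x y => simp [actionMap]
  | add x y hx hy => simp only [TensorProduct.add_tmul, map_add, hx, hy]

theorem smashMul_tmul' (a b : A) (h k : H) :
    ρ.smashMul ((a ⊗ₜ h) ⊗ₜ (b ⊗ₜ k)) =
      TensorProduct.map (LinearMap.mulLeft ℂ a) (LinearMap.mulRight ℂ k) (ρ.tau (h ⊗ₜ b)) := by
  simp only [smashMul, LinearMap.comp_apply, TensorProduct.map_tmul, LinearMap.id_apply,
    LinearEquiv.coe_coe, TensorProduct.assoc_tmul, TensorProduct.assoc_symm_tmul]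
  induction ρ.tau (h ⊗ₜ b) using TensorProduct.induction_on with
  | zero => simp
  | tmul x y => simp
  | add x y hx hy => simp only [TensorProduct.add_tmul, TensorProduct.tmul_add, map_add, hx, hy]

theorem smashMul_tmul (a b : A) (h k : H) :
    ρ.smashMul ((a ⊗ₜ h) ⊗ₜ (b ⊗ₜ k)) =
      TensorProduct.map (LinearMap.mulLeft ℂ a ∘ₗ ρ.act.toLinearMap.flip b)
        (LinearMap.mulRight ℂ k) (comul (R := ℂ) h) := by
  rw [smashMul_tmul', tau_tmul, ← LinearMap.comp_apply, ← TensorProduct.map_comp]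
  simp

theorem smashMul_one_left (u : A ⊗[ℂ] H) : ρ.smashMul (((1 : A) ⊗ₜ (1 : H)) ⊗ₜ u) = u := by
  induction u using TensorProduct.induction_on with
  | zero => simp
  | tmul a h => simp [smashMul_tmul, Algebra.TensorProduct.one_def]
  | add x y hx hy => simp only [TensorProduct.tmul_add, map_add, hx, hy]

theorem smashMul_one_right (u : A ⊗[ℂ] H) : ρ.smashMul (u ⊗ₜ ((1 : A) ⊗ₜ (1 : H))) = u := by
  induction u using TensorProduct.induction_on with
  | zero => simp
  | tmul a h =>
    rw [smashMul_tmul, ← (Coalgebra.Repr.arbitrary ℂ h).eq]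
    simp only [map_sum, TensorProduct.map_tmul, LinearMap.comp_apply, LinearMap.flip_apply,
      LinearMap.mulLeft_apply, LinearMap.mulRight_apply, AlgHom.toLinearMap_apply, ρ.act_one,
      mul_one, mul_smul_comm, TensorProduct.smul_tmul, ← TensorProduct.tmul_sum]
    rw [Coalgebra.sum_counit_smul]
  | add x y hx hy => simp only [TensorProduct.add_tmul, map_add, hx, hy]

/-- The map `x ⊗ (y ⊗ z) ↦ a (x • b) (y • d) ⊗ z m`. -/
def assocMap (a b d : A) (m : H) : H ⊗[ℂ] (H ⊗[ℂ] H) →ₗ[ℂ] A ⊗[ℂ] H :=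
  TensorProduct.map
    (LinearMap.mul' ℂ A ∘ₗ TensorProduct.map
      (LinearMap.mulLeft ℂ a ∘ₗ ρ.act.toLinearMap.flip b) (ρ.act.toLinearMap.flip d))
    (LinearMap.mulRight ℂ m) ∘ₗ (TensorProduct.assoc ℂ H H H).symm.toLinearMap

theorem assocMap_left (a b d : A) (m : H) (k₁ : H) (x : H) (z : H ⊗[ℂ] H) (k₂ : H) :
    ρ.assocMap a b (ρ.act k₁ d) (k₂ * m) (x ⊗ₜ z) =
      TensorProduct.map (LinearMap.mulLeft ℂ (a * ρ.act x b) ∘ₗ ρ.act.toLinearMap.flip d)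
        (LinearMap.mulRight ℂ m) (z * (k₁ ⊗ₜ k₂)) := by
  induction z using TensorProduct.induction_on with
  | zero => simp
  | tmul y z => simp [assocMap, mul_assoc]
  | add y z hy hz => simp only [TensorProduct.tmul_add, map_add, add_mul, hy, hz]

theorem assocMap_right (a b d : A) (m : H) (z : H ⊗[ℂ] H) (y : H) :
    ρ.assocMap a b d m (TensorProduct.assoc ℂ H H H (z ⊗ₜ y)) =
      (a * LinearMap.mul' ℂ A (TensorProduct.map (ρ.act.toLinearMap.flip b)
        (ρ.act.toLinearMap.flip d) z)) ⊗ₜ (y * m) := by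
  induction z using TensorProduct.induction_on with
  | zero => simp
  | tmul x z => simp [assocMap, mul_assoc]
  | add x z hx hz => simp only [TensorProduct.add_tmul, map_add, mul_add, hx, hz]

theorem smashMul_assoc (u v w : A ⊗[ℂ] H) :
    ρ.smashMul (ρ.smashMul (u ⊗ₜ v) ⊗ₜ w) = ρ.smashMul (u ⊗ₜ ρ.smashMul (v ⊗ₜ w)) := by
  induction u using TensorProduct.induction_on with
  | zero => simp
  | add x y hx hy => simp only [TensorProduct.add_tmul, map_add, hx, hy]
  | tmul a h =>
  induction v using TensorProduct.induction_on with
  | zero => simp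
  | add x y hx hy => simp only [TensorProduct.add_tmul, TensorProduct.tmul_add, map_add, hx, hy]
  | tmul b k =>
  induction w using TensorProduct.induction_on with
  | zero => simp
  | add x y hx hy => simp only [TensorProduct.tmul_add, map_add, hx, hy]
  | tmul c l =>
  rw [smashMul_tmul, smashMul_tmul ρ b c k l]
  have hk := (Coalgebra.Repr.arbitrary ℂ k).eq
  set R := Coalgebra.Repr.arbitrary ℂ k
  -- the left-hand side, as a function of `comul h`
  have hL : ∀ z : H ⊗[ℂ] H, ρ.smashMul (TensorProduct.map
      (LinearMap.mulLeft ℂ a ∘ₗ ρ.act.toLinearMap.flip b) (LinearMap.mulRight ℂ k) z ⊗ₜ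
        (c ⊗ₜ[ℂ] l)) = ∑ i ∈ R.index,
      ρ.assocMap a b (ρ.act (R.left i) c) (R.right i * l)
        ((comul (R := ℂ) (A := H)).lTensor H z) := by
    intro z
    induction z using TensorProduct.induction_on with
    | zero => simp
    | tmul x y =>
      simp only [TensorProduct.map_tmul, LinearMap.comp_apply, LinearMap.mulLeft_apply,
        LinearMap.mulRight_apply, LinearMap.flip_apply, AlgHom.toLinearMap_apply, smashMul_tmul,
        LinearMap.lTensor_tmul, assocMap_left, Bialgebra.comul_mul]
      rw [← map_sum, ← Finset.mul_sum, hk]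
    | add y z hy hz =>
      simp only [map_add, TensorProduct.add_tmul, hy, hz, Finset.sum_add_distrib]
  -- the right-hand side, as a function of `comul h`
  have hR : ∀ (d : A) (m : H) (z : H ⊗[ℂ] H), TensorProduct.map
      (LinearMap.mulLeft ℂ a ∘ₗ ρ.act.toLinearMap.flip (b * d)) (LinearMap.mulRight ℂ m) z =
      ρ.assocMap a b d m (TensorProduct.assoc ℂ H H H
        ((comul (R := ℂ) (A := H)).rTensor H z)) := by
    intro d m z
    induction z using TensorProduct.induction_on with
    | zero => simp
    | tmul x y =>
      simp only [TensorProduct.map_tmul, LinearMap.comp_apply, LinearMap.mulLeft_apply,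
        LinearMap.mulRight_apply, LinearMap.flip_apply, AlgHom.toLinearMap_apply,
        LinearMap.rTensor_tmul, assocMap_right, ρ.act_mul]
    | add y z hy hz => simp only [map_add, hy, hz]
  rw [hL, ← hk]
  simp only [map_sum, TensorProduct.tmul_sum, TensorProduct.map_tmul, LinearMap.comp_apply,
    LinearMap.mulLeft_apply, LinearMap.mulRight_apply, LinearMap.flip_apply,
    AlgHom.toLinearMap_apply, smashMul_tmul, hR, Coalgebra.coassoc_apply]

theorem smashMul_smul_left (c : ℂ) (u v : A ⊗[ℂ] H) :
    ρ.smashMul ((c • u) ⊗ₜ v) = c • ρ.smashMul (u ⊗ₜ v) := by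
  rw [← map_smul, TensorProduct.smul_tmul']

theorem smashMul_smul_right (c : ℂ) (u v : A ⊗[ℂ] H) :
    ρ.smashMul (u ⊗ₜ (c • v)) = c • ρ.smashMul (u ⊗ₜ v) := by
  rw [← map_smul, TensorProduct.tmul_smul]

/-- The smash product `A # H`. -/
def Smash (_ρ : ModuleAlgebra H A) : Type _ := A ⊗[ℂ] H

instance : AddCommGroup ρ.Smash := inferInstanceAs (AddCommGroup (A ⊗[ℂ] H))
instance : Module ℂ ρ.Smash := inferInstanceAs (Module ℂ (A ⊗[ℂ] H))

instance : Ring ρ.Smash where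
  __ := (inferInstance : AddCommGroup ρ.Smash)
  mul u v := ρ.smashMul (u ⊗ₜ v)
  one := (1 : A) ⊗ₜ[ℂ] (1 : H)
  left_distrib u v w := (congrArg ρ.smashMul (TensorProduct.tmul_add u v w)).trans (map_add _ _ _)
  right_distrib u v w := (congrArg ρ.smashMul (TensorProduct.add_tmul u v w)).trans (map_add _ _ _)
  zero_mul u := (congrArg ρ.smashMul (TensorProduct.zero_tmul _ u)).trans (map_zero _)
  mul_zero u := (congrArg ρ.smashMul (TensorProduct.tmul_zero _ u)).trans (map_zero _)
  mul_assoc := ρ.smashMul_assoc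
  one_mul := ρ.smashMul_one_left
  mul_one := ρ.smashMul_one_right

instance : Algebra ℂ ρ.Smash := Algebra.ofModule
  (fun c u v => ρ.smashMul_smul_left c u v) (fun c u v => ρ.smashMul_smul_right c u v)

/-- The element `a ⊗ h` of the smash product. -/
def smashTmul (a : A) (h : H) : ρ.Smash := a ⊗ₜ[ℂ] h

end ModuleAlgebra
end Smash

/-! ### The `H`-completion and the analytic smash product -/

section Analytic

open Coalgebra

/-- The multiplication `𝒜 ⊗̂ 𝒜 → 𝒜` of a complete locally convex algebra. -/
def mulHat (𝒜 : Type*) [Ring 𝒜] [Algebra ℂ 𝒜] [UniformSpace 𝒜] [CompleteLCS 𝒜]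
    [IsTopologicalRing 𝒜] : CTP 𝒜 𝒜 →L[ℂ] 𝒜 :=
  CTP.lift ⟨LinearMap.mul ℂ 𝒜, continuous_mul⟩

theorem mulHat_mk {𝒜 : Type*} [Ring 𝒜] [Algebra ℂ 𝒜] [UniformSpace 𝒜] [CompleteLCS 𝒜]
    [IsTopologicalRing 𝒜] (x y : 𝒜) : mulHat 𝒜 (CTP.mk x y) = x * y := CTP.lift_mk _ _ _

section General

variable {𝒜 ℋ : Type*} [Ring 𝒜] [Algebra ℂ 𝒜] [UniformSpace 𝒜] [CompleteLCS 𝒜]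
  [IsTopologicalRing 𝒜] [Ring ℋ] [Algebra ℂ ℋ] [UniformSpace ℋ] [CompleteLCS ℋ]
  [IsTopologicalRing ℋ]

/-- The map `τ : ℋ ⊗̂ 𝒜 → 𝒜 ⊗̂ ℋ` given by a comultiplication and an action. -/
def tauHat (Δ : ℋ →L[ℂ] CTP ℋ ℋ) (act : CTP ℋ 𝒜 →L[ℂ] 𝒜) : CTP ℋ 𝒜 →L[ℂ] CTP 𝒜 ℋ :=
  CTP.map act (.id ℂ ℋ) ∘L
  CTP.assocSymm ℋ 𝒜 ℋ ∘L
  CTP.map (.id ℂ ℋ) (CTP.comm ℋ 𝒜) ∘L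
  CTP.assoc ℋ ℋ 𝒜 ∘L
  CTP.map Δ (.id ℂ 𝒜)

/-- The multiplication of the analytic smash product, given by a comultiplication and an
action. -/
def smashMulHat (Δ : ℋ →L[ℂ] CTP ℋ ℋ) (act : CTP ℋ 𝒜 →L[ℂ] 𝒜) :
    CTP (CTP 𝒜 ℋ) (CTP 𝒜 ℋ) →L[ℂ] CTP 𝒜 ℋ :=
  CTP.map (mulHat 𝒜) (mulHat ℋ) ∘L
  CTP.assocSymm 𝒜 𝒜 (CTP ℋ ℋ) ∘L
  CTP.map (.id ℂ 𝒜) (CTP.assoc 𝒜 ℋ ℋ) ∘L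
  CTP.map (.id ℂ 𝒜) (CTP.map (tauHat Δ act) (.id ℂ ℋ)) ∘L
  CTP.map (.id ℂ 𝒜) (CTP.assocSymm ℋ 𝒜 ℋ) ∘L
  CTP.assoc 𝒜 ℋ (CTP 𝒜 ℋ)

end General

theorem projSeminorm_submul {A B : Type*} [Ring A] [Algebra ℂ A] [Ring B] [Algebra ℂ B]
    {p : Seminorm ℂ A} {q : Seminorm ℂ B}
    (hp : p ∈ submulSeminorms A) (hq : q ∈ submulSeminorms B) :
    projSeminorm p q ∈ submulSeminorms (A ⊗[ℂ] B) := by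
  have h1 : ∀ (a : A) (b : B) (v : A ⊗[ℂ] B), projSeminorm p q ((a ⊗ₜ b) * v) ≤
      (p a * q b) * projSeminorm p q v := by
    intro a b v
    refine le_projSeminorm (r := (projSeminorm p q).comp (LinearMap.mulLeft ℂ (a ⊗ₜ b)))
      (mul_nonneg (apply_nonneg _ _) (apply_nonneg _ _)) (fun e f => ?_) v
    simp only [Seminorm.comp_apply, LinearMap.mulLeft_apply, Algebra.TensorProduct.tmul_mul_tmul]
    calc _ ≤ p (a * e) * q (b * f) := projSeminorm_tmul_le _ _ _ _
      _ ≤ (p a * p e) * (q b * q f) := mul_le_mul (hp _ _) (hq _ _) (apply_nonneg _ _)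
          (mul_nonneg (apply_nonneg _ _) (apply_nonneg _ _))
      _ = _ := by ring
  intro u v
  rw [mul_comm (projSeminorm p q u)]
  refine le_projSeminorm (r := (projSeminorm p q).comp (LinearMap.mulRight ℂ v))
    (apply_nonneg _ _) (fun e f => ?_) u
  rw [mul_comm]
  exact h1 e f v

variable {H A : Type*} [Ring H] [Bialgebra ℂ H] [Ring A] [Algebra ℂ A]

theorem continuous_comul_aux : Continuous (fun h : AMTop H =>
    CTP.ofTensor (AMEnvelope H) (AMEnvelope H)
      (TensorProduct.map (toAMEnvelope H).toLinearMap (toAMEnvelope H).toLinearMap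
        (comul (R := ℂ) (A := H) h))) := by
  refine WithSeminorms.continuous_of_continuous_comp
    (PolynormableSpace.withSeminorms ℂ (CTP (AMEnvelope H) (AMEnvelope H)))
    (show AMTop H →ₗ[ℂ] CTP (AMEnvelope H) (AMEnvelope H) from
      CTP.ofTensor (AMEnvelope H) (AMEnvelope H) ∘ₗ
      TensorProduct.map (toAMEnvelope H).toLinearMap (toAMEnvelope H).toLinearMap ∘ₗ
      comul (R := ℂ) (A := H)) fun r => ?_
  obtain ⟨p, q, hp, hq, h⟩ := (CTP.tmul (AMEnvelope H) (AMEnvelope H)).exists_bound r.1 r.2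
  have hS : SemTop.Saturated (submulSeminorms H) := SubmulFamily.saturated
  obtain ⟨p', hp', hpp'⟩ := hS.exists_le (p.comp (toCompl (AMTop H)).toLinearMap)
    (hp.comp (toCompl (AMTop H)).continuous)
  obtain ⟨q', hq', hqq'⟩ := hS.exists_le (q.comp (toCompl (AMTop H)).toLinearMap)
    (hq.comp (toCompl (AMTop H)).continuous)
  have hm : (projSeminorm p' q').comp (comul (R := ℂ) (A := H)) ∈ submulSeminorms H := by
    intro a b
    simp only [Seminorm.comp_apply, Bialgebra.comul_mul]
    exact projSeminorm_submul hp' hq' _ _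
  refine Seminorm.continuous_of_le
    (q := (show Seminorm ℂ (AMTop H) from (projSeminorm p' q').comp (comul (R := ℂ) (A := H))))
    (SemTop.continuous_of_mem _ hm) fun x => ?_
  have := le_projSeminorm (p := p') (q := q') (C := 1)
    (r := r.1.comp (CTP.ofTensor (AMEnvelope H) (AMEnvelope H) ∘ₗ
      TensorProduct.map (toAMEnvelope H).toLinearMap (toAMEnvelope H).toLinearMap)) zero_le_one
    (fun e f => by
      rw [one_mul]
      exact (h _ _).trans (mul_le_mul (hpp' e) (hqq' f) (apply_nonneg _ _) (apply_nonneg _ _)))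
    (comul (R := ℂ) (A := H) x)
  rw [one_mul] at this
  exact this

/-- The comultiplication `Ĥ → Ĥ ⊗̂ Ĥ` of the Arens-Michael envelope of a bialgebra: the
continuous extension of the comultiplication of `H`. -/
def comulHat (H : Type*) [Ring H] [Bialgebra ℂ H] :
    AMEnvelope H →L[ℂ] CTP (AMEnvelope H) (AMEnvelope H) :=
  ContinuousLinearMap.extend
    (⟨(show AMTop H →ₗ[ℂ] CTP (AMEnvelope H) (AMEnvelope H) from
      CTP.ofTensor (AMEnvelope H) (AMEnvelope H) ∘ₗ
      TensorProduct.map (toAMEnvelope H).toLinearMap (toAMEnvelope H).toLinearMap ∘ₗ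
      comul (R := ℂ) (A := H)), continuous_comul_aux⟩ :
      AMTop H →L[ℂ] CTP (AMEnvelope H) (AMEnvelope H))
    (toCompl (AMTop H))

theorem comulHat_coe (h : H) : comulHat H (toAMEnvelope H h) =
    CTP.ofTensor (AMEnvelope H) (AMEnvelope H)
      (TensorProduct.map (toAMEnvelope H).toLinearMap (toAMEnvelope H).toLinearMap
        (comul (R := ℂ) h)) :=
  ContinuousLinearMap.extend_eq _ denseRange_toCompl isUniformInducing_toCompl
    (show AMTop H from h)

namespace ModuleAlgebra

variable (ρ : ModuleAlgebra H A)

/-- The `H`-stable submultiplicative seminorms on an `H`-module algebra. -/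
def stableSeminorms : Set (Seminorm ℂ A) :=
  {p | p ∈ submulSeminorms A ∧ ∀ h : H, ∃ C : ℝ, 0 < C ∧ ∀ a : A, p (ρ.act h a) ≤ C * p a}

instance : SubmulFamily ρ.stableSeminorms where
  subset := fun _ hp => hp.1
  saturated :=
    { bot_mem := ⟨fun a b => by simp, fun h => ⟨1, one_pos, fun a => by simp⟩⟩
      sup_mem := fun p hp q hq => ⟨submul_sup hp.1 hq.1, fun h => by
        obtain ⟨C, hC, h1⟩ := hp.2 h
        obtain ⟨D, hD, h2⟩ := hq.2 h
        refine ⟨max C D, lt_max_of_lt_left hC, fun a => ?_⟩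
        simp only [Seminorm.sup_apply]
        exact max_le ((h1 a).trans (mul_le_mul (le_max_left _ _) (le_max_left _ _) (by simp)
            (hC.le.trans (le_max_left _ _))))
          ((h2 a).trans (mul_le_mul (le_max_right _ _) (le_max_right _ _) (by simp)
            (hC.le.trans (le_max_left _ _))))⟩
      smul_mem := fun p hp C hC => ⟨submul_smul hp.1 hC, fun h => by
        obtain ⟨D, hD, h1⟩ := hp.2 h
        refine ⟨D, hD, fun a => ?_⟩
        simp only [smul_apply, NNReal.smul_def, smul_eq_mul]
        calc (C : ℝ) * p (ρ.act h a) ≤ C * (D * p a) := by gcongr; exact h1 a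
          _ = _ := by ring⟩ }

/-- The algebra `A` with the topology given by the `H`-stable submultiplicative seminorms. -/
abbrev StableTop : Type _ := SemTop A ρ.stableSeminorms

/-- The `H`-completion `Ã` of an `H`-module algebra `A`. -/
abbrev HCompletion : Type _ := Completion ρ.StableTop

/-- The canonical homomorphism `A → Ã`. -/
def toHCompletion : A →ₐ[ℂ] ρ.HCompletion where
  toFun a := ((show ρ.StableTop from a) : ρ.HCompletion)
  map_one' := Completion.coe_one _
  map_mul' a b := Completion.coe_mul (α := ρ.StableTop) a b
  map_zero' := Completion.coe_zero
  map_add' a b := Completion.coe_add (α := ρ.StableTop) a b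
  commutes' _ := rfl

/-- The operator seminorm on `H` defined by a stable seminorm on `A`. -/
def opSeminorm (p : Seminorm ℂ A) : Seminorm ℂ H :=
  ⨆ a : {a : A // p a ≤ 1}, p.comp (ρ.act.toLinearMap.flip a.1)

variable {ρ} in
theorem bddAbove_opSeminorm {p : Seminorm ℂ A} (hp : p ∈ ρ.stableSeminorms) :
    BddAbove (Set.range fun a : {a : A // p a ≤ 1} => p.comp (ρ.act.toLinearMap.flip a.1)) := by
  rw [Seminorm.bddAbove_range_iff]
  intro h
  obtain ⟨C, hC, hb⟩ := hp.2 h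
  refine ⟨C, ?_⟩
  rintro _ ⟨a, rfl⟩
  exact (hb a.1).trans (mul_le_of_le_one_right hC.le a.2)

variable {ρ} in
theorem le_opSeminorm {p : Seminorm ℂ A} (hp : p ∈ ρ.stableSeminorms) (h : H) (a : A) :
    p (ρ.act h a) ≤ ρ.opSeminorm p h * p a := by
  rcases (apply_nonneg p a).eq_or_lt with h0 | h0
  · obtain ⟨C, -, hb⟩ := hp.2 h
    have := hb a
    rw [← h0, mul_zero] at this ⊢
    exact this
  · have hn : ‖(((p a)⁻¹ : ℝ) : ℂ)‖ = (p a)⁻¹ := by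
      rw [Complex.norm_real, Real.norm_of_nonneg (by positivity)]
    have h1 := le_ciSup (bddAbove_opSeminorm hp) ⟨(((p a)⁻¹ : ℝ) : ℂ) • a, by
      rw [map_smul_eq_mul, hn, inv_mul_cancel₀ h0.ne']⟩ h
    have h2 : p (ρ.act h ((((p a)⁻¹ : ℝ) : ℂ) • a)) ≤ ρ.opSeminorm p h := h1
    rw [map_smul, map_smul_eq_mul, hn, inv_mul_le_iff₀ h0] at h2
    linarith

variable {ρ} in
theorem opSeminorm_submul {p : Seminorm ℂ A} (hp : p ∈ ρ.stableSeminorms) :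
    ρ.opSeminorm p ∈ submulSeminorms H := by
  intro g h
  rw [opSeminorm, Seminorm.iSup_apply (bddAbove_opSeminorm hp)]
  refine Real.iSup_le (fun a => ?_) (mul_nonneg (apply_nonneg _ _) (apply_nonneg _ _))
  simp only [Seminorm.comp_apply, LinearMap.flip_apply, AlgHom.toLinearMap_apply, map_mul,
    Module.End.mul_apply]
  calc _ ≤ ρ.opSeminorm p g * p (ρ.act h a.1) := le_opSeminorm hp _ _
    _ ≤ ρ.opSeminorm p g * (ρ.opSeminorm p h * p a.1) := by gcongr; exact le_opSeminorm hp _ _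
    _ ≤ ρ.opSeminorm p g * (ρ.opSeminorm p h * 1) := by gcongr; exact a.2
    _ = _ := by rw [mul_one]; rfl

/-- The action `H × A → Ã`. -/
def actionBilin : CBilin (AMTop H) ρ.StableTop ρ.HCompletion where
  toBilin := (show AMTop H →ₗ[ℂ] ρ.StableTop →ₗ[ℂ] ρ.StableTop from
    ρ.act.toLinearMap).compr₂ (toCompl ρ.StableTop).toLinearMap
  cont := by
    refine (toCompl ρ.StableTop).continuous.comp (continuous_of_bound
      (show AMTop H →ₗ[ℂ] ρ.StableTop →ₗ[ℂ] ρ.StableTop from ρ.act.toLinearMap) fun r hr => ?_)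
    have hS : SemTop.Saturated ρ.stableSeminorms := SubmulFamily.saturated
    obtain ⟨p, hp, hrp⟩ := hS.exists_le r hr
    exact ⟨ρ.opSeminorm p, p, SemTop.continuous_of_mem _ (opSeminorm_submul hp),
      SemTop.continuous_of_mem _ hp, fun h a => (hrp _).trans (le_opSeminorm hp h a)⟩

/-- The action `Ĥ ⊗̂ Ã → Ã`: the continuous extension of the action of `H` on `A`. -/
def actionHat : CTP (AMEnvelope H) ρ.HCompletion →L[ℂ] ρ.HCompletion :=
  CTP.lift (ρ.actionBilin.extend (toCompl (AMTop H)) (toCompl ρ.StableTop)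
    isDenseInducing_toCompl isDenseInducing_toCompl)

theorem actionHat_coe (h : H) (a : A) :
    ρ.actionHat (CTP.mk (toAMEnvelope H h) (ρ.toHCompletion a)) =
      ρ.toHCompletion (ρ.act h a) := by
  rw [actionHat, CTP.lift_mk]
  exact CBilin.extend_apply _ _ _ _ _ (show AMTop H from h) (show ρ.StableTop from a)

end ModuleAlgebra
end Analytic

section Dense

theorem dense_assoc {V X : Type*} [TopologicalSpace X] [T2Space X] (j : V → X) (hj : DenseRange j)
    (m : X → X → X) (hm : Continuous fun z : X × X => m z.1 z.2) (n : V → V → V)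
    (h : ∀ u v, m (j u) (j v) = j (n u v))
    (hn : ∀ u v w, n (n u v) w = n u (n v w)) (x y z : X) :
    m (m x y) z = m x (m y z) := by
  have h2 : ∀ {Y : Type _} [TopologicalSpace Y] {f g : Y → X}, Continuous f → Continuous g →
      Continuous fun y => m (f y) (g y) := fun hf hg => hm.comp (hf.prodMk hg)
  refine hj.induction_on₃ (p := fun x y z => m (m x y) z = m x (m y z)) ?_ ?_ x y z
  · exact isClosed_eq (h2 (h2 (by fun_prop) (by fun_prop)) (by fun_prop))
      (h2 (by fun_prop) (h2 (by fun_prop) (by fun_prop)))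
  · intro u v w
    rw [h, h, h, h, hn]

theorem dense_one_left {V X : Type*} [TopologicalSpace X] [T2Space X] (j : V → X) (hj : DenseRange j)
    (m : X → X → X) (hm : Continuous fun z : X × X => m z.1 z.2) (n : V → V → V)
    (h : ∀ u v, m (j u) (j v) = j (n u v))
    (e : V) {x₁ : X} (he : j e = x₁) (hn : ∀ u, n e u = u) (x : X) :
    m x₁ x = x :=
  hj.induction_on (p := fun x => m x₁ x = x) x
    (isClosed_eq (hm.comp (continuous_const.prodMk continuous_id)) continuous_id)
    fun u => by rw [← he, h, hn]

theorem dense_one_right {V X : Type*} [TopologicalSpace X] [T2Space X] (j : V → X) (hj : DenseRange j)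
    (m : X → X → X) (hm : Continuous fun z : X × X => m z.1 z.2) (n : V → V → V)
    (h : ∀ u v, m (j u) (j v) = j (n u v))
    (e : V) {x₁ : X} (he : j e = x₁) (hn : ∀ u, n u e = u) (x : X) :
    m x x₁ = x :=
  hj.induction_on (p := fun x => m x x₁ = x) x
    (isClosed_eq (hm.comp (continuous_id.prodMk continuous_const)) continuous_id)
    fun u => by rw [← he, h, hn]

end Dense

section AnalyticSmash

open Coalgebra

variable {H A : Type*} [Ring H] [Bialgebra ℂ H] [Ring A] [Algebra ℂ A]

namespace ModuleAlgebra

variable (ρ : ModuleAlgebra H A)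

/-- The analytic smash product `Ã #̂ Ĥ`, as a locally convex space equal to `Ã ⊗̂ Ĥ`. -/
def AnalyticSmash : Type _ := CTP ρ.HCompletion (AMEnvelope H)

instance : AddCommGroup ρ.AnalyticSmash :=
  inferInstanceAs (AddCommGroup (CTP ρ.HCompletion (AMEnvelope H)))
instance : Module ℂ ρ.AnalyticSmash :=
  inferInstanceAs (Module ℂ (CTP ρ.HCompletion (AMEnvelope H)))
instance : UniformSpace ρ.AnalyticSmash :=
  inferInstanceAs (UniformSpace (CTP ρ.HCompletion (AMEnvelope H)))
instance : CompleteLCS ρ.AnalyticSmash :=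
  inferInstanceAs (CompleteLCS (CTP ρ.HCompletion (AMEnvelope H)))

/-- The multiplication `(Ã ⊗̂ Ĥ) × (Ã ⊗̂ Ĥ) → Ã ⊗̂ Ĥ` of the analytic smash product. -/
def analyticMul (u v : CTP ρ.HCompletion (AMEnvelope H)) : CTP ρ.HCompletion (AMEnvelope H) :=
  smashMulHat (comulHat H) ρ.actionHat (CTP.mk u v)

/-- The canonical linear map `A ⊗ H → Ã ⊗̂ Ĥ`. -/
def canLin : A ⊗[ℂ] H →ₗ[ℂ] CTP ρ.HCompletion (AMEnvelope H) :=
  CTP.ofTensor ρ.HCompletion (AMEnvelope H) ∘ₗ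
    TensorProduct.map ρ.toHCompletion.toLinearMap (toAMEnvelope H).toLinearMap

theorem canLin_tmul (a : A) (h : H) :
    ρ.canLin (a ⊗ₜ h) = CTP.mk (ρ.toHCompletion a) (toAMEnvelope H h) := rfl

theorem tauHat_coe (h : H) (b : A) :
    tauHat (comulHat H) ρ.actionHat (CTP.mk (toAMEnvelope H h) (ρ.toHCompletion b)) =
      ρ.canLin (ρ.tau (h ⊗ₜ b)) := by
  simp only [tauHat, ContinuousLinearMap.comp_apply, CTP.map_mk, comulHat_coe, tau_tmul,
    ContinuousLinearMap.id_apply]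
  induction comul (R := ℂ) h using TensorProduct.induction_on with
  | zero => simp [CTP.zero_mk, CTP.mk_zero]
  | tmul x y =>
    simp only [TensorProduct.map_tmul, CTP.ofTensor_tmul, AlgHom.toLinearMap_apply, CTP.assoc_mk,
      CTP.map_mk, ContinuousLinearMap.id_apply, CTP.comm_mk, CTP.assocSymm_mk, actionHat_coe,
      canLin_tmul, LinearMap.flip_apply, LinearMap.id_apply]
  | add x y hx hy => simp only [map_add, CTP.add_mk, CTP.mk_add, hx, hy]

theorem analyticMul_coe (u v : A ⊗[ℂ] H) :
    ρ.analyticMul (ρ.canLin u) (ρ.canLin v) = ρ.canLin (ρ.smashMul (u ⊗ₜ v)) := by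
  unfold analyticMul
  induction u using TensorProduct.induction_on with
  | zero => simp [CTP.zero_mk, CTP.mk_zero]
  | add x y hx hy =>
    simp only [map_add, CTP.add_mk, TensorProduct.add_tmul, hx, hy]
  | tmul a h =>
  induction v using TensorProduct.induction_on with
  | zero => simp [CTP.zero_mk, CTP.mk_zero]
  | add x y hx hy => simp only [map_add, CTP.mk_add, TensorProduct.tmul_add, hx, hy]
  | tmul b k =>
  simp only [smashMulHat, ContinuousLinearMap.comp_apply, canLin_tmul, CTP.map_mk, CTP.assoc_mk,
    CTP.assocSymm_mk, ContinuousLinearMap.id_apply, tauHat_coe, smashMul_tmul']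
  induction ρ.tau (h ⊗ₜ b) using TensorProduct.induction_on with
  | zero => simp [CTP.zero_mk, CTP.mk_zero]
  | tmul x y =>
    simp only [canLin_tmul, CTP.map_mk, CTP.assoc_mk, CTP.assocSymm_mk,
      ContinuousLinearMap.id_apply, mulHat_mk, TensorProduct.map_tmul, LinearMap.mulLeft_apply,
      LinearMap.mulRight_apply, map_mul]
  | add x y hx hy => simp only [map_add, CTP.add_mk, CTP.mk_add, hx, hy]

theorem continuous_analyticMul :
    Continuous fun z : CTP ρ.HCompletion (AMEnvelope H) × CTP ρ.HCompletion (AMEnvelope H) =>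
      ρ.analyticMul z.1 z.2 :=
  (smashMulHat (comulHat H) ρ.actionHat).continuous.comp (CTP.tmul _ _).cont

theorem denseRange_canLin : DenseRange ρ.canLin := by
  let N : Submodule ℂ (CTP ρ.HCompletion (AMEnvelope H)) :=
    (LinearMap.range ρ.canLin).topologicalClosure
  have h1 : ∀ (x : ρ.HCompletion) (y : AMEnvelope H), CTP.mk x y ∈ N := by
    intro x y
    have hc : IsClosed {z : ρ.HCompletion × AMEnvelope H | CTP.mk z.1 z.2 ∈ N} :=
      (Submodule.isClosed_topologicalClosure _).preimage (CTP.tmul _ _).cont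
    have hd : DenseRange (Prod.map (toCompl ρ.StableTop) (toCompl (AMTop H))) :=
      denseRange_toCompl.prodMap denseRange_toCompl
    exact hd.induction_on (p := fun z => CTP.mk z.1 z.2 ∈ N) (x, y) hc fun z =>
      Submodule.le_topologicalClosure _ ⟨(show A from z.1) ⊗ₜ (show H from z.2), rfl⟩
  have h2 : ∀ t, CTP.ofTensor ρ.HCompletion (AMEnvelope H) t ∈ N := by
    intro t
    induction t using TensorProduct.induction_on with
    | zero => simp
    | tmul x y => exact h1 x y
    | add x y hx hy => rw [map_add]; exact N.add_mem hx hy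
  intro x
  have h3 := CTP.denseRange_ofTensor ρ.HCompletion (AMEnvelope H) x
  have h4 : closure (Set.range (CTP.ofTensor ρ.HCompletion (AMEnvelope H))) ⊆ N :=
    closure_minimal (by rintro _ ⟨t, rfl⟩; exact h2 t) (Submodule.isClosed_topologicalClosure _)
  exact h4 h3

theorem analyticMul_assoc (u v w : CTP ρ.HCompletion (AMEnvelope H)) :
    ρ.analyticMul (ρ.analyticMul u v) w = ρ.analyticMul u (ρ.analyticMul v w) :=
  dense_assoc ρ.canLin ρ.denseRange_canLin ρ.analyticMul ρ.continuous_analyticMul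
    (fun u v => ρ.smashMul (u ⊗ₜ v)) ρ.analyticMul_coe ρ.smashMul_assoc u v w

theorem analyticMul_one_left (u : CTP ρ.HCompletion (AMEnvelope H)) :
    ρ.analyticMul (CTP.mk 1 1) u = u :=
  dense_one_left ρ.canLin ρ.denseRange_canLin ρ.analyticMul ρ.continuous_analyticMul
    (fun u v => ρ.smashMul (u ⊗ₜ v)) ρ.analyticMul_coe ((1 : A) ⊗ₜ (1 : H))
    (by rw [canLin_tmul, map_one, map_one]) ρ.smashMul_one_left u

theorem analyticMul_one_right (u : CTP ρ.HCompletion (AMEnvelope H)) :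
    ρ.analyticMul u (CTP.mk 1 1) = u :=
  dense_one_right ρ.canLin ρ.denseRange_canLin ρ.analyticMul ρ.continuous_analyticMul
    (fun u v => ρ.smashMul (u ⊗ₜ v)) ρ.analyticMul_coe ((1 : A) ⊗ₜ (1 : H))
    (by rw [canLin_tmul, map_one, map_one]) ρ.smashMul_one_right u

section
variable (u v w : CTP ρ.HCompletion (AMEnvelope H)) (c : ℂ)

theorem analyticMul_add :
    ρ.analyticMul u (v + w) = ρ.analyticMul u v + ρ.analyticMul u w := by
  simp only [analyticMul, CTP.mk_add, map_add]

theorem add_analyticMul :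
    ρ.analyticMul (u + v) w = ρ.analyticMul u w + ρ.analyticMul v w := by
  simp only [analyticMul, CTP.add_mk, map_add]

theorem zero_analyticMul : ρ.analyticMul 0 u = 0 := by
  simp only [analyticMul, CTP.zero_mk, map_zero]

theorem analyticMul_zero : ρ.analyticMul u 0 = 0 := by
  simp only [analyticMul, CTP.mk_zero, map_zero]

theorem smul_analyticMul : ρ.analyticMul (c • u) v = c • ρ.analyticMul u v := by
  simp only [analyticMul, CTP.smul_mk, map_smul]

theorem analyticMul_smul : ρ.analyticMul u (c • v) = c • ρ.analyticMul u v := by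
  simp only [analyticMul, CTP.mk_smul, map_smul]

end

instance : Ring ρ.AnalyticSmash where
  __ := (inferInstance : AddCommGroup ρ.AnalyticSmash)
  mul u v := ρ.analyticMul u v
  one := CTP.mk (1 : ρ.HCompletion) (1 : AMEnvelope H)
  left_distrib := ρ.analyticMul_add
  right_distrib := ρ.add_analyticMul
  zero_mul := ρ.zero_analyticMul
  mul_zero := ρ.analyticMul_zero
  mul_assoc := ρ.analyticMul_assoc
  one_mul := ρ.analyticMul_one_left
  mul_one := ρ.analyticMul_one_right

instance : Algebra ℂ ρ.AnalyticSmash := Algebra.ofModule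
  (fun c u v => ρ.smul_analyticMul u v c) (fun c u v => ρ.analyticMul_smul u v c)

instance : IsTopologicalRing ρ.AnalyticSmash where
  continuous_mul := ρ.continuous_analyticMul
  continuous_neg := continuous_neg

/-- The canonical homomorphism `A # H → Ã #̂ Ĥ`, `a ⊗ h ↦ a ⊗ h`. -/
def toAnalyticSmash : ρ.Smash →ₐ[ℂ] ρ.AnalyticSmash :=
  AlgHom.ofLinearMap (show ρ.Smash →ₗ[ℂ] ρ.AnalyticSmash from ρ.canLin)
    ((ρ.canLin_tmul 1 1).trans (by rw [map_one, map_one]; rfl))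
    (fun u v => (ρ.analyticMul_coe u v).symm)

end ModuleAlgebra
end AnalyticSmash

/-! ### The quantum plane -/

section QuantumPlane

/-- A monoid `G` acting on `A` by algebra endomorphisms makes `A` into a `ℂG`-module algebra. -/
def ModuleAlgebra.ofEndomorphisms {G A : Type*} [AddMonoid G] [Ring A] [Algebra ℂ A]
    (φ : Multiplicative G →* (A →ₐ[ℂ] A)) : ModuleAlgebra (AddMonoidAlgebra ℂ G) A where
  act := AddMonoidAlgebra.lift ℂ (Module.End ℂ A) G
    { toFun := fun g => (φ g).toLinearMap
      map_one' := by rw [map_one]; rfl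
      map_mul' := fun g g' => by rw [map_mul]; rfl }
  act_one h := by
    induction h using AddMonoidAlgebra.induction_linear with
    | zero => simp
    | add f g hf hg => simp only [map_add, LinearMap.add_apply, hf, hg, add_smul]
    | single g c => simp [AddMonoidAlgebra.lift_single]
  act_mul h a b := by
    induction h using AddMonoidAlgebra.induction_linear with
    | zero => simp
    | add f g hf hg => simp only [map_add, LinearMap.add_apply, hf, hg]
    | single g c => simp [AddMonoidAlgebra.lift_single]

/-- The action of the additive semigroup `ℤ₊` on `ℂ[x]` by `(k • f)(x) = f(q⁻ᵏ x)`, as a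
module algebra over the semigroup algebra `ℂℤ₊`. -/
def qAction (q : ℂ) : ModuleAlgebra (AddMonoidAlgebra ℂ ℕ) (Polynomial ℂ) :=
  ModuleAlgebra.ofEndomorphisms
    { toFun := fun k => Polynomial.aeval (Polynomial.C (q ^ k.toAdd)⁻¹ * Polynomial.X)
      map_one' := by ext; simp
      map_mul' := fun k l => by
        refine Polynomial.algHom_ext ?_
        simp only [toAdd_mul, pow_add, mul_inv, map_mul, Polynomial.aeval_X, AlgHom.mul_apply,
          Polynomial.aeval_C, Polynomial.algebraMap_eq]
        ring }

/-- The basis element `δ_k` of the semigroup algebra `ℂℤ₊`. -/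
def delta (k : ℕ) : AddMonoidAlgebra ℂ ℕ := AddMonoidAlgebra.single k 1

/-- The defining relation `x y = q y x` of the quantum plane, on the free algebra on
`x = ι 0` and `y = ι 1`. -/
inductive QuantumPlaneRel (q : ℂ) : FreeAlgebra ℂ (Fin 2) → FreeAlgebra ℂ (Fin 2) → Prop
  | rel : QuantumPlaneRel q (FreeAlgebra.ι ℂ 0 * FreeAlgebra.ι ℂ 1)
      (q • (FreeAlgebra.ι ℂ 1 * FreeAlgebra.ι ℂ 0))

/-- Manin's quantum plane `ℂ_q[x, y] = ℂ⟨x, y | x y = q y x⟩`. -/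
abbrev QuantumPlane (q : ℂ) : Type := RingQuot (QuantumPlaneRel q)

namespace QuantumPlane

/-- The generator `x` of the quantum plane. -/
def x (q : ℂ) : QuantumPlane q := RingQuot.mkAlgHom ℂ (QuantumPlaneRel q) (FreeAlgebra.ι ℂ 0)

/-- The generator `y` of the quantum plane. -/
def y (q : ℂ) : QuantumPlane q := RingQuot.mkAlgHom ℂ (QuantumPlaneRel q) (FreeAlgebra.ι ℂ 1)

end QuantumPlane

end QuantumPlane

/-! ### Spaces of double sequences -/

section DoubleSeries

open scoped NNReal

variable {I : Type*} (w : I → ℕ × ℕ → ℝ≥0)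

/-- The space of double sequences `c` with `‖c‖ᵢ = ∑ |c_n| w i n < ∞` for all `i`. -/
def weightedSubmodule : Submodule ℂ (ℕ × ℕ → ℂ) where
  carrier := {c | ∀ i, Summable fun n => ‖c n‖ * w i n}
  zero_mem' i := by simp
  add_mem' {c d} hc hd i := by
    refine Summable.of_nonneg_of_le (fun n => by positivity) (fun n => ?_) ((hc i).add (hd i))
    rw [← add_mul]
    exact mul_le_mul_of_nonneg_right (norm_add_le _ _) (w i n).2
  smul_mem' a c hc i := by
    simpa [mul_assoc] using (hc i).mul_left ‖a‖

/-- The seminorm `‖c‖ᵢ = ∑ |c_n| w i n`. -/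
def weightedSeminorm (i : I) : Seminorm ℂ (weightedSubmodule w) :=
  Seminorm.of (fun c => ∑' n, ‖(c : ℕ × ℕ → ℂ) n‖ * w i n)
    (fun c d => by
      rw [← (c.2 i).tsum_add (d.2 i)]
      refine Summable.tsum_le_tsum (fun n => ?_) ((c + d).2 i) ((c.2 i).add (d.2 i))
      rw [← add_mul]
      exact mul_le_mul_of_nonneg_right (norm_add_le _ _) (w i n).2)
    (fun a c => by simp [mul_assoc, tsum_mul_left])

/-- The space of double sequences with `‖c‖ᵢ < ∞` for all `i`, with the topology given by the
seminorms `‖·‖ᵢ`. -/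
abbrev WeightedSpace : Type _ :=
  SemTop (weightedSubmodule w) (Set.range (weightedSeminorm w))

/-- The `n`-th coordinate of a double sequence. -/
def WeightedSpace.coord {w : I → ℕ × ℕ → ℝ≥0} (c : WeightedSpace w) (n : ℕ × ℕ) : ℂ :=
  (show weightedSubmodule w from c).1 n

/-- The weights of `‖c‖_{ρ,N} = ∑_{i ≤ N} ∑_j |c_{ij}| ρ^j`. -/
def formalEntireWeight : {ρ : ℝ≥0 // 0 < ρ} × ℕ → ℕ × ℕ → ℝ≥0 :=
  fun s n => if n.1 ≤ s.2 then s.1.1 ^ n.2 else 0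

/-- The weights of `‖c‖_ρ = ∑_{i,j} |c_{ij}| |q|^{ij} ρ^{i+j}`. -/
def quantumWeight (q : ℂ) : {ρ : ℝ≥0 // 0 < ρ} → ℕ × ℕ → ℝ≥0 :=
  fun ρ n => ‖q‖₊ ^ (n.1 * n.2) * ρ.1 ^ (n.1 + n.2)

end DoubleSeries

end AMSmash

end

open AMSmash
open scoped PowerSeries.WithPiTopology

/-!
All the completions are compared on the monomials `x^i y^j`, where they become weighted `ℓ¹`-spaces.
Since `δ₁ · x^n = q^{-n} x^n`, a stable seminorm `p` satisfies `|q|^{-n} p(x^n) ≤ C p(x^n)`; for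
`|q| < 1` this forces `p(x^n) = 0` for large `n`. Hence `Ã = ℂ[[x]]`, and `Ã #̂ Ĥ` imposes no growth
condition in `i`. On the quantum plane, `x^i y^j = q^{ij} y^j x^i` bounds every submultiplicative
seminorm by weights `|q|^{ij} ρ^{i+j}`, and for `|q| ≤ 1` these weights are themselves
submultiplicative. The canonical map `(A # H)^ → Ã #̂ Ĥ` is therefore an inclusion of weighted
spaces, and its image misses `∑ x^i`.
-/

noncomputable section

namespace AMSmash

open scoped TensorProduct Topology NNReal
open Filter UniformSpace

/-! ### Completions of a vector space with respect to a set of seminorms -/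

section Extension

variable {D X Y : Type*}

theorem exists_continuousLinearMap_of_denseRange [AddCommGroup D] [Module ℂ D]
    [AddCommGroup X] [Module ℂ X] [UniformSpace X] [IsUniformAddGroup X] [ContinuousConstSMul ℂ X]
    [AddCommGroup Y] [Module ℂ Y] [UniformSpace Y] [IsUniformAddGroup Y] [ContinuousConstSMul ℂ Y]
    [CompleteSpace Y] [T2Space Y] {f : D →ₗ[ℂ] X} (hf : DenseRange f) (g : D →ₗ[ℂ] Y)
    {ι : Type*} {Q : SeminormFamily ℂ Y ι} (hQ : WithSeminorms Q)
    (h : ∀ i, ∃ r : Seminorm ℂ X, Continuous r ∧ ∀ d, Q i (g d) ≤ r (f d)) :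
    ∃ φ : X →L[ℂ] Y, ∀ d, φ (f d) = g d := by
  let _ : UniformSpace D := UniformSpace.comap f inferInstance
  have : IsUniformAddGroup D := IsUniformAddGroup.comap f
  have hfu : IsUniformInducing f := ⟨rfl⟩
  have hfc : Continuous f := hfu.uniformContinuous.continuous
  have hg : Continuous g :=
    hQ.continuous_of_continuous_comp g fun i => by
      obtain ⟨r, hr, hb⟩ := h i
      exact Seminorm.continuous_of_le (q := r.comp f) (hr.comp hfc) hb
  exact ⟨ContinuousLinearMap.extend ⟨g, hg⟩ ⟨f, hfc⟩,
    ContinuousLinearMap.extend_eq (e := ⟨f, hfc⟩) ⟨g, hg⟩ hf hfu⟩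

theorem map_mul_of_denseRange [Semiring D] [Algebra ℂ D]
    [Semiring X] [Algebra ℂ X] [TopologicalSpace X] [ContinuousMul X]
    [Semiring Y] [Algebra ℂ Y] [TopologicalSpace Y] [ContinuousMul Y] [T2Space Y]
    {f : D →ₐ[ℂ] X} (hf : DenseRange f) {g : D →ₐ[ℂ] Y} {φ : X → Y} (hφ : Continuous φ)
    (h : ∀ d, φ (f d) = g d) (x y : X) : φ (x * y) = φ x * φ y :=
  hf.induction_on₂ (isClosed_eq (by fun_prop) (by fun_prop))
    (fun a b => by rw [← map_mul, h, h, h, map_mul]) x y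

theorem continuousAlgHom_ext_of_denseRange [Semiring X] [Algebra ℂ X] [TopologicalSpace X]
    [Semiring Y] [Algebra ℂ Y] [TopologicalSpace Y] [T2Space Y] {f : D → X} (hf : DenseRange f)
    {Φ Ψ : X →A[ℂ] Y} (h : ∀ d, Φ (f d) = Ψ (f d)) : Φ = Ψ :=
  DFunLike.coe_injective (hf.equalizer Φ.cont Ψ.cont (funext h))

theorem exists_continuousAlgHom_of_denseRange [Semiring D] [Algebra ℂ D]
    [Semiring X] [Algebra ℂ X] [TopologicalSpace X] [ContinuousMul X]
    [Semiring Y] [Algebra ℂ Y] [TopologicalSpace Y] [ContinuousMul Y] [T2Space Y]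
    {f : D →ₐ[ℂ] X} (hf : DenseRange f) {g : D →ₐ[ℂ] Y} (φ : X →L[ℂ] Y)
    (h : ∀ d, φ (f d) = g d) : ∃ Φ : X →A[ℂ] Y, ∀ x, Φ x = φ x :=
  ⟨⟨AlgHom.ofLinearMap φ.toLinearMap (by simpa using h 1)
    (map_mul_of_denseRange hf φ.continuous h), φ.continuous⟩, fun _ => rfl⟩

theorem exists_continuousAlgEquiv_of_denseRange [Semiring D] [Algebra ℂ D]
    [Semiring X] [Algebra ℂ X] [TopologicalSpace X] [ContinuousMul X]
    [Semiring Y] [Algebra ℂ Y] [TopologicalSpace Y] [ContinuousMul Y] [T2Space Y]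
    {f : D →ₐ[ℂ] X} (hf : DenseRange f) {g : D →ₐ[ℂ] Y} (e : X ≃L[ℂ] Y)
    (h : ∀ d, e (f d) = g d) : ∃ E : X ≃A[ℂ] Y, ∀ x, E x = e x :=
  ⟨⟨AlgEquiv.ofLinearEquiv e.toLinearEquiv (by simpa using h 1)
    (map_mul_of_denseRange hf e.continuous h), e.continuous, e.symm.continuous⟩, fun _ => rfl⟩

end Extension

section SeminormCompletion

variable {D X Y : Type*} [AddCommGroup D] [Module ℂ D]
  [AddCommGroup X] [Module ℂ X] [UniformSpace X]
  [AddCommGroup Y] [Module ℂ Y] [UniformSpace Y]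

/-- `f : D → X` exhibits `X` as the Hausdorff completion of `D` for the topology generated by `S`:
its range is dense, and the seminorms in `S` and the continuous seminorms of `X`, restricted
to `D`, dominate each other. Completeness of `X` is a separate assumption. It is the common
description of Arens-Michael envelopes, `H`-completions and analytic smash products. -/
structure IsSeminormCompletion (S : Set (Seminorm ℂ D)) (f : D →ₗ[ℂ] X) : Prop where
  denseRange : DenseRange f
  exists_continuous_ge : ∀ p ∈ S, ∃ r : Seminorm ℂ X, Continuous r ∧ ∀ d, p d ≤ r (f d)
  exists_mem_ge : ∀ r : Seminorm ℂ X, Continuous r → ∃ p ∈ S, ∀ d, r (f d) ≤ p d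

namespace IsSeminormCompletion

variable {S : Set (Seminorm ℂ D)} {f : D →ₗ[ℂ] X}

theorem exists_continuousLinearEquiv [CompleteLCS X] [IsUniformAddGroup Y] [ContinuousConstSMul ℂ Y]
    [CompleteSpace Y] [T2Space Y] (hf : IsSeminormCompletion S f)
    {g : D →ₗ[ℂ] Y} (hg : DenseRange g)
    {ι : Type*} {Q : SeminormFamily ℂ Y ι} (hQ : WithSeminorms Q)
    (h₁ : ∀ i, ∃ p ∈ S, ∀ d, Q i (g d) ≤ p d)
    (h₂ : ∀ p ∈ S, ∃ r : Seminorm ℂ Y, Continuous r ∧ ∀ d, p d ≤ r (g d)) :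
    ∃ e : X ≃L[ℂ] Y, ∀ d, e (f d) = g d := by
  obtain ⟨φ, hφ⟩ : ∃ φ : X →L[ℂ] Y, ∀ d, φ (f d) = g d := by
    refine exists_continuousLinearMap_of_denseRange hf.denseRange g hQ fun i => ?_
    obtain ⟨p, hp, hQp⟩ := h₁ i
    obtain ⟨r, hr, hpr⟩ := hf.exists_continuous_ge p hp
    exact ⟨r, hr, fun d => (hQp d).trans (hpr d)⟩
  obtain ⟨ψ, hψ⟩ : ∃ ψ : Y →L[ℂ] X, ∀ d, ψ (g d) = f d := by
    refine exists_continuousLinearMap_of_denseRange hg f (PolynormableSpace.withSeminorms ℂ X)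
      fun r => ?_
    obtain ⟨p, hp, hrp⟩ := hf.exists_mem_ge r.1 r.2
    obtain ⟨s, hs, hps⟩ := h₂ p hp
    exact ⟨s, hs, fun d => (hrp d).trans (hps d)⟩
  refine ⟨.equivOfInverse φ ψ (congr_fun ?_) (congr_fun ?_), hφ⟩
  · exact hf.denseRange.equalizer (ψ.continuous.comp φ.continuous) continuous_id
      (funext fun d => by simp [hφ, hψ])
  · exact hg.equalizer (φ.continuous.comp ψ.continuous) continuous_id
      (funext fun d => by simp [hφ, hψ])

end IsSeminormCompletion

/-- The canonical map from `E` to its completion for the topology generated by `S`. -/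
def SemTop.toCompletion (S : Set (Seminorm ℂ D)) : D →ₗ[ℂ] Completion (SemTop D S) :=
  (show SemTop D S →ₗ[ℂ] _ from (toCompl (SemTop D S)).toLinearMap)

theorem SemTop.Saturated.isSeminormCompletion {S : Set (Seminorm ℂ D)} (hS : Saturated S) :
    IsSeminormCompletion S (toCompletion S) where
  denseRange := denseRange_toCompl (E := SemTop D S)
  exists_continuous_ge p hp := ⟨completionSeminorm (E := SemTop D S) p (continuous_of_mem S hp),
    continuous_completionSeminorm _ _, fun d => (completionSeminorm_coe (E := SemTop D S) _ _ d).ge⟩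
  exists_mem_ge r hr :=
    hS.exists_le (r.comp (toCompletion S)) (hr.comp (toCompl (SemTop D S)).continuous)

theorem isSeminormCompletion_toAMEnvelope (B : Type*) [Ring B] [Algebra ℂ B] :
    IsSeminormCompletion (submulSeminorms B) (toAMEnvelope B).toLinearMap :=
  SubmulFamily.saturated.isSeminormCompletion

theorem ModuleAlgebra.isSeminormCompletion_toHCompletion {H A : Type*} [Ring H] [Bialgebra ℂ H]
    [Ring A] [Algebra ℂ A] (ρ : ModuleAlgebra H A) :
    IsSeminormCompletion ρ.stableSeminorms ρ.toHCompletion.toLinearMap :=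
  SubmulFamily.saturated.isSeminormCompletion

end SeminormCompletion

section AnalyticSmash

variable {H A : Type*} [Ring H] [Bialgebra ℂ H] [Ring A] [Algebra ℂ A] (ρ : ModuleAlgebra H A)

namespace ModuleAlgebra

theorem exists_analyticSmash_toCTP : ∃ φ : ρ.AnalyticSmash →L[ℂ] CTP ρ.StableTop (AMTop H),
    ∀ u, φ (ρ.canLin u) = CTP.ofTensor ρ.StableTop (AMTop H) u := by
  let β := (CTP.tmul ρ.StableTop (AMTop H)).extend (toCompl ρ.StableTop) (toCompl (AMTop H))
    isDenseInducing_toCompl isDenseInducing_toCompl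
  refine ⟨CTP.lift β, fun u => LinearMap.congr_fun (TensorProduct.ext' fun a h => ?_ :
    (CTP.lift β).toLinearMap ∘ₗ ρ.canLin = CTP.ofTensor ρ.StableTop (AMTop H)) u⟩
  exact (CTP.lift_mk β _ _).trans
    (CBilin.extend_apply (E := ρ.StableTop) (F := AMTop H) _ _ _ _ _ a h)

theorem exists_continuous_ge_projSeminorm {p : Seminorm ℂ A} (hp : p ∈ ρ.stableSeminorms)
    {p' : Seminorm ℂ H} (hp' : p' ∈ submulSeminorms H) :
    ∃ r : Seminorm ℂ ρ.AnalyticSmash, Continuous r ∧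
      ∀ u, projSeminorm p p' u ≤ r (ρ.canLin u) := by
  obtain ⟨φ, hφ⟩ := ρ.exists_analyticSmash_toCTP
  have hpp' : projSeminorm p p' ∈ projSeminorms ρ.StableTop (AMTop H) :=
    ⟨p, p', SemTop.continuous_of_mem _ hp, SemTop.continuous_of_mem _ hp',
      projSeminorm_tmul_le p p'⟩
  obtain ⟨r, hr, hle⟩ := (projSeminorms_saturated ρ.StableTop
    (AMTop H)).isSeminormCompletion.exists_continuous_ge (projSeminorm p p') hpp'
  refine ⟨r.comp φ.toLinearMap, hr.comp φ.continuous, fun u => (hle u).trans_eq ?_⟩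
  exact congrArg r (hφ u).symm

theorem exists_projSeminorm_ge (r : Seminorm ℂ ρ.AnalyticSmash) (hr : Continuous r) :
    ∃ p ∈ ρ.stableSeminorms, ∃ p' ∈ submulSeminorms H,
      ∀ u, r (ρ.canLin u) ≤ projSeminorm p p' u := by
  obtain ⟨s, s', hs, hs', hss'⟩ :=
    (CTP.tmul ρ.HCompletion (AMEnvelope H)).exists_bound r hr
  obtain ⟨p, hp, hsp⟩ := ρ.isSeminormCompletion_toHCompletion.exists_mem_ge s hs
  obtain ⟨p', hp', hsp'⟩ := (isSeminormCompletion_toAMEnvelope H).exists_mem_ge s' hs'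
  refine ⟨p, hp, p', hp', fun u => ?_⟩
  rw [← one_mul (projSeminorm p p' u)]
  refine le_projSeminorm (r := r.comp ρ.canLin) zero_le_one (fun a h => ?_) u
  rw [one_mul]
  exact (hss' _ _).trans
    (mul_le_mul (hsp a) (hsp' h) (apply_nonneg _ _) (apply_nonneg _ _))

theorem isSeminormCompletion_toAnalyticSmash :
    IsSeminormCompletion (Set.image2 projSeminorm ρ.stableSeminorms (submulSeminorms H))
      (D := ρ.Smash) ρ.toAnalyticSmash.toLinearMap where
  denseRange := ρ.denseRange_canLin
  exists_continuous_ge := by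
    rintro _ ⟨p, hp, p', hp', rfl⟩
    exact ρ.exists_continuous_ge_projSeminorm hp hp'
  exists_mem_ge r hr := by
    obtain ⟨p, hp, p', hp', hr'⟩ := ρ.exists_projSeminorm_ge r hr
    exact ⟨_, Set.mem_image2_of_mem hp hp', hr'⟩

end ModuleAlgebra

end AnalyticSmash

/-! ### Weighted `ℓ¹`-seminorms -/

section BasisSeminorm

variable {ι E : Type*} [AddCommGroup E] [Module ℂ E] (b : Module.Basis ι ℂ E) (w : ι → ℝ≥0)

theorem summable_norm_repr_mul (u : E) : Summable fun n => ‖b.repr u n‖ * (w n : ℝ) := by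
  refine summable_of_hasFiniteSupport ((b.repr u).support.finite_toSet.subset fun n hn => ?_)
  have : b.repr u n ≠ 0 := norm_ne_zero_iff.1 (left_ne_zero_of_mul hn)
  simpa

/-- The seminorm `∑ |c_n| w_n` of `∑ c_n b_n`. These seminorms bound all the completions below
from both sides. -/
def basisSeminorm : Seminorm ℂ E :=
  Seminorm.of (fun u => ∑' n, ‖b.repr u n‖ * (w n : ℝ))
    (fun u v => by
      rw [← (summable_norm_repr_mul b w u).tsum_add (summable_norm_repr_mul b w v)]
      refine Summable.tsum_le_tsum (fun n => ?_) (summable_norm_repr_mul b w _)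
        ((summable_norm_repr_mul b w u).add (summable_norm_repr_mul b w v))
      rw [← add_mul, map_add]
      exact mul_le_mul_of_nonneg_right (norm_add_le _ _) (w n).2)
    (fun a u => by simp [mul_assoc, tsum_mul_left])

theorem basisSeminorm_apply (u : E) :
    basisSeminorm b w u = ∑ n ∈ (b.repr u).support, ‖b.repr u n‖ * (w n : ℝ) :=
  tsum_eq_sum fun n hn => by simp [Finsupp.notMem_support_iff.1 hn]

theorem basisSeminorm_basis (n : ι) : basisSeminorm b w (b n) = w n := by
  simp [basisSeminorm_apply]

theorem norm_repr_mul_le_basisSeminorm (u : E) (n : ι) :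
    ‖b.repr u n‖ * w n ≤ basisSeminorm b w u :=
  (summable_norm_repr_mul b w u).le_tsum n fun _ _ => by positivity

theorem le_basisSeminorm {p : Seminorm ℂ E} {C : ℝ} (h : ∀ n, p (b n) ≤ C * w n) (u : E) :
    p u ≤ C * basisSeminorm b w u := by
  calc p u = p (∑ n ∈ (b.repr u).support, b.repr u n • b n) :=
        congrArg p (b.linearCombination_repr u).symm
    _ ≤ ∑ n ∈ (b.repr u).support, p (b.repr u n • b n) :=
      Finset.le_sum_of_subadditive p (map_zero p).le (map_add_le_add p) _ _
    _ ≤ ∑ n ∈ (b.repr u).support, ‖b.repr u n‖ * (C * w n) := by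
      gcongr with n
      rw [map_smul_eq_mul]
      exact mul_le_mul_of_nonneg_left (h n) (norm_nonneg _)
    _ = C * basisSeminorm b w u := by
      simp only [basisSeminorm_apply, Finset.mul_sum, mul_left_comm]

theorem basisSeminorm_tensorProduct_le_projSeminorm {κ F : Type*} [AddCommGroup F] [Module ℂ F]
    (b' : Module.Basis κ ℂ F) (w' : κ → ℝ≥0) (t : E ⊗[ℂ] F) :
    basisSeminorm (b.tensorProduct b') (fun n => w n.1 * w' n.2) t ≤
      projSeminorm (basisSeminorm b w) (basisSeminorm b' w') t := by
  let r := basisSeminorm (b.tensorProduct b') fun n => w n.1 * w' n.2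
  have h_basis (m : ι) (n : κ) : r (b m ⊗ₜ b' n) = w m * w' n := by
    rw [← Module.Basis.tensorProduct_apply]
    exact basisSeminorm_basis _ _ _
  have h_left (m : ι) (f : F) : r (b m ⊗ₜ f) ≤ w m * basisSeminorm b' w' f :=
    le_basisSeminorm b' w' (p := r.comp (TensorProduct.mk ℂ E F (b m)))
      (fun n => (h_basis m n).le) f
  have h (e : E) (f : F) : r (e ⊗ₜ f) ≤ 1 * (basisSeminorm b w e * basisSeminorm b' w' f) := by
    rw [one_mul, mul_comm]
    exact le_basisSeminorm b w (p := r.comp ((TensorProduct.mk ℂ E F).flip f))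
      (fun m => (h_left m f).trans_eq (mul_comm _ _)) e
  simpa using le_projSeminorm zero_le_one h t

end BasisSeminorm

section Submultiplicative

variable {A : Type*} [Ring A] [Algebra ℂ A]

theorem basisSeminorm_mem_submulSeminorms {ι : Type*} (b : Module.Basis ι ℂ A) (w : ι → ℝ≥0)
    (h : ∀ m n, basisSeminorm b w (b m * b n) ≤ w m * w n) :
    basisSeminorm b w ∈ submulSeminorms A := by
  have h_left (m : ι) (v : A) : basisSeminorm b w (b m * v) ≤ w m * basisSeminorm b w v :=
    le_basisSeminorm b w (p := (basisSeminorm b w).comp (LinearMap.mulLeft ℂ (b m))) (h m) v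
  intro u v
  rw [mul_comm (basisSeminorm b w u)]
  exact le_basisSeminorm b w (p := (basisSeminorm b w).comp (LinearMap.mulRight ℂ v))
    (fun m => (h_left m v).trans_eq (mul_comm _ _)) u

theorem submul_pow_le {p : Seminorm ℂ A} (hp : p ∈ submulSeminorms A) (a : A) (n : ℕ) :
    p (a ^ n) ≤ p 1 * p a ^ n := by
  induction n with
  | zero => simp
  | succ n ih =>
    rw [pow_succ, pow_succ, ← mul_assoc]
    exact (hp _ _).trans (mul_le_mul_of_nonneg_right ih (apply_nonneg _ _))

end Submultiplicative

/-! ### Weighted spaces of double sequences -/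

namespace WeightedSpace

variable {I : Type*} {w : I → ℕ × ℕ → ℝ≥0}

theorem ext_coord {c d : WeightedSpace w} (h : ∀ n, c.coord n = d.coord n) : c = d :=
  Subtype.ext (funext h)

/-- The `n`-th coordinate as a linear functional. -/
def coordLin (w : I → ℕ × ℕ → ℝ≥0) (n : ℕ × ℕ) : WeightedSpace w →ₗ[ℂ] ℂ :=
  (show weightedSubmodule w →ₗ[ℂ] ℂ from LinearMap.proj n ∘ₗ (weightedSubmodule w).subtype)

theorem coordLin_apply (c : WeightedSpace w) (n : ℕ × ℕ) : coordLin w n c = c.coord n := rfl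

theorem summable_norm_coord_mul (c : WeightedSpace w) (i : I) :
    Summable fun n => ‖c.coord n‖ * (w i n : ℝ) :=
  (show weightedSubmodule w from c).2 i

/-- The `i`-th defining seminorm, as a seminorm on the topological vector space. -/
def sem (w : I → ℕ × ℕ → ℝ≥0) (i : I) : Seminorm ℂ (WeightedSpace w) := weightedSeminorm w i

theorem sem_apply (c : WeightedSpace w) (i : I) :
    sem w i c = ∑' n, ‖c.coord n‖ * (w i n : ℝ) := rfl

theorem continuous_sem (i : I) : Continuous (sem w i) :=
  SemTop.continuous_of_mem (Set.range (weightedSeminorm w)) ⟨i, rfl⟩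

theorem withSeminorms_sem : WithSeminorms (sem w) := by
  rw [SeminormFamily.withSeminorms_iff_nhds_eq_iInf]
  exact ((SeminormFamily.withSeminorms_iff_nhds_eq_iInf _).1 (SemTop.withSeminorms _)).trans
    (iInf_range' (fun s : Seminorm ℂ (weightedSubmodule w) => comap s (𝓝 (0 : ℝ))) _)

/-- The embedding into a product of copies of `ℓ¹`, which yields completeness. -/
def toLp (w : I → ℕ × ℕ → ℝ≥0) : WeightedSpace w →ₗ[ℂ] I → lp (fun _ : ℕ × ℕ => ℂ) 1 where
  toFun c i := ⟨fun n => c.coord n * (w i n : ℝ),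
    (memℓp_gen_iff (by simp)).2 (by simpa using c.summable_norm_coord_mul i)⟩
  map_add' c d := by
    ext i n
    exact add_mul (c.coord n) (d.coord n) _
  map_smul' a c := by
    ext i n
    exact mul_assoc a (c.coord n) _

theorem toLp_apply (c : WeightedSpace w) (i : I) (n : ℕ × ℕ) :
    toLp w c i n = c.coord n * (w i n : ℝ) := rfl

theorem norm_toLp (c : WeightedSpace w) (i : I) : ‖toLp w c i‖ = sem w i c := by
  rw [lp.norm_eq_tsum_rpow (by simp), sem_apply]
  simp [toLp_apply]

theorem isUniformInducing_toLp : IsUniformInducing (toLp w) := by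
  refine AddMonoidHom.isUniformInducing_of_isInducing
    (IsTopologicalAddGroup.isInducing_iff_nhds_zero.2 ?_)
  rw [(SeminormFamily.withSeminorms_iff_nhds_eq_iInf _).1 withSeminorms_sem, nhds_pi,
    Filter.pi, Filter.comap_iInf]
  refine iInf_congr fun i => ?_
  rw [Pi.zero_apply, ← comap_norm_nhds_zero (E := lp (fun _ : ℕ × ℕ => ℂ) 1), Filter.comap_comap,
    Filter.comap_comap]
  exact congrArg (fun s => Filter.comap s (𝓝 (0 : ℝ))) (funext fun c => (norm_toLp c i).symm)

section Complete

variable (hw : ∀ n, ∃ i, 0 < w i n)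
include hw

theorem toLp_injective : Function.Injective (toLp w) := by
  refine fun c d h => ext_coord fun n => ?_
  obtain ⟨i, hi⟩ := hw n
  have hwn : ((w i n : ℝ) : ℂ) ≠ 0 := by exact_mod_cast hi.ne'
  exact mul_right_cancel₀ hwn (congrArg (fun z : I → lp (fun _ : ℕ × ℕ => ℂ) 1 => z i n) h)

theorem t2Space : T2Space (WeightedSpace w) :=
  T2Space.of_injective_continuous (toLp_injective hw) isUniformInducing_toLp.isInducing.continuous

theorem range_toLp : Set.range (toLp w) = {z | ∀ i j n,
    z i n * ((w j n : ℝ) : ℂ) = z j n * ((w i n : ℝ) : ℂ)} := by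
  refine Set.Subset.antisymm ?_ fun z hz => ?_
  · rintro _ ⟨c, rfl⟩ i j n
    exact mul_right_comm (c.coord n) _ _
  choose k hk using hw
  have hk' (n : ℕ × ℕ) : ((w (k n) n : ℝ) : ℂ) ≠ 0 := by exact_mod_cast (hk n).ne'
  have hzk (i : I) (n : ℕ × ℕ) : z (k n) n / (w (k n) n : ℝ) * (w i n : ℝ) = z i n := by
    rw [div_mul_eq_mul_div, div_eq_iff (hk' n), hz]
  have hmem : (fun n => z (k n) n / (w (k n) n : ℝ)) ∈ weightedSubmodule w := fun i => by
    have := (memℓp_gen_iff (by simp)).1 (z i).2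
    simpa [← hzk i] using this
  refine ⟨(⟨_, hmem⟩ : weightedSubmodule w), ?_⟩
  ext i n
  exact hzk i n

theorem completeSpace : CompleteSpace (WeightedSpace w) := by
  rw [completeSpace_iff_isComplete_range isUniformInducing_toLp, range_toLp hw]
  have hcont (i : I) (n : ℕ × ℕ) :
      Continuous fun z : I → lp (fun _ : ℕ × ℕ => ℂ) 1 => z i n :=
    (lp.evalCLM ℂ (fun _ : ℕ × ℕ => ℂ) 1 n).continuous.comp (continuous_apply i)
  refine IsClosed.isComplete ?_
  simp only [Set.ofPred_forall]
  exact isClosed_iInter fun i => isClosed_iInter fun j => isClosed_iInter fun n =>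
    isClosed_eq ((hcont i n).mul_const _) ((hcont j n).mul_const _)

end Complete

end WeightedSpace

namespace WeightedSpace

variable {I : Type*} {w : I → ℕ × ℕ → ℝ≥0}

section OfBasis

variable {E : Type*} [AddCommGroup E] [Module ℂ E] (b : Module.Basis (ℕ × ℕ) ℂ E)

/-- The coordinate map of a basis, seen as a map to a weighted space. -/
def ofBasis (w : I → ℕ × ℕ → ℝ≥0) : E →ₗ[ℂ] WeightedSpace w :=
  (show E →ₗ[ℂ] weightedSubmodule w from
    { toFun := fun u => ⟨b.repr u, fun i => summable_norm_repr_mul b (w i) u⟩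
      map_add' := fun u v => Subtype.ext (by ext; simp)
      map_smul' := fun a u => Subtype.ext (by ext; simp) })

theorem coord_ofBasis (u : E) (n : ℕ × ℕ) : (ofBasis b w u).coord n = b.repr u n := rfl

theorem coord_ofBasis_basis (n : ℕ × ℕ) : (ofBasis b w (b n)).coord = Pi.single n 1 := by
  ext m
  rw [coord_ofBasis, b.repr_self, Finsupp.single_eq_pi_single]

theorem sem_ofBasis_sum_sub (c : WeightedSpace w) (s : Finset (ℕ × ℕ)) (i : I) :
    sem w i (ofBasis b w (∑ n ∈ s, c.coord n • b n) - c) =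
      ∑' n : {n // n ∉ s}, ‖c.coord n‖ * (w i n : ℝ) := by
  have hcoord (n : ℕ × ℕ) : (ofBasis b w (∑ m ∈ s, c.coord m • b m) - c).coord n =
      if n ∈ s then 0 else -c.coord n := by
    rw [← coordLin_apply, map_sub, coordLin_apply, coordLin_apply, coord_ofBasis]
    by_cases hn : n ∈ s <;> simp [Finsupp.single_apply, hn]
  simp only [sem_apply, hcoord]
  refine Eq.trans (tsum_congr fun n => ?_)
    (tsum_subtype {n | n ∉ s} fun n => ‖c.coord n‖ * (w i n : ℝ)).symm
  by_cases hn : n ∈ s <;> simp [hn, Set.indicator]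

theorem denseRange_ofBasis : DenseRange (ofBasis b w) := by
  intro c
  have hlim : Tendsto (fun s => ofBasis b w (∑ n ∈ s, c.coord n • b n)) atTop (𝓝 c) := by
    refine (withSeminorms_sem.tendsto_nhds _ _).2 fun i ε hε => ?_
    simp only [sem_ofBasis_sum_sub]
    exact (tendsto_order.1 (tendsto_tsum_compl_atTop_zero
      fun n => ‖c.coord n‖ * (w i n : ℝ))).2 ε hε
  exact mem_closure_of_tendsto hlim (Eventually.of_forall fun s => Set.mem_range_self _)

end OfBasis

section Inclusion

variable {J : Type*} {v : J → ℕ × ℕ → ℝ≥0} (h : ∀ j, ∃ i, ∀ n, v j n ≤ w i n)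
include h

/-- The inclusion of a weighted space into the one with smaller weights. -/
def inclusion : WeightedSpace w →L[ℂ] WeightedSpace v :=
  let L : WeightedSpace w →ₗ[ℂ] WeightedSpace v :=
    { toFun c := (⟨c.coord, fun j => by
        obtain ⟨i, hi⟩ := h j
        exact (c.summable_norm_coord_mul i).of_nonneg_of_le (fun n => by positivity)
          fun n => mul_le_mul_of_nonneg_left (hi n) (norm_nonneg _)⟩ : weightedSubmodule v)
      map_add' _ _ := rfl
      map_smul' _ _ := rfl }
  ⟨L, withSeminorms_sem.continuous_of_continuous_comp L fun j => by
    obtain ⟨i, hi⟩ := h j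
    refine Seminorm.continuous_of_le (continuous_sem i) fun c => ?_
    exact Summable.tsum_le_tsum (fun n => mul_le_mul_of_nonneg_left (hi n) (norm_nonneg _))
      (summable_norm_coord_mul (L c) j) (c.summable_norm_coord_mul i)⟩

theorem coord_inclusion (c : WeightedSpace w) : (inclusion h c).coord = c.coord := rfl

theorem inclusion_ofBasis {E : Type*} [AddCommGroup E] [Module ℂ E]
    (b : Module.Basis (ℕ × ℕ) ℂ E) (u : E) : inclusion h (ofBasis b w u) = ofBasis b v u := rfl

end Inclusion

end WeightedSpace

theorem IsSeminormCompletion.exists_equiv_weightedSpace {D X : Type*} [AddCommGroup D] [Module ℂ D]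
    [AddCommGroup X] [Module ℂ X] [UniformSpace X] [CompleteLCS X]
    {S : Set (Seminorm ℂ D)} {f : D →ₗ[ℂ] X} (hf : IsSeminormCompletion S f)
    (b : Module.Basis (ℕ × ℕ) ℂ D) {I : Type*} {w : I → ℕ × ℕ → ℝ≥0} (hw : ∀ n, ∃ i, 0 < w i n)
    (h₁ : ∀ i, ∃ p ∈ S, ∀ u, basisSeminorm b (w i) u ≤ p u)
    (h₂ : ∀ p ∈ S, ∃ (i : I) (C : ℝ≥0), ∀ n, p (b n) ≤ C * w i n) :
    ∃ e : X ≃L[ℂ] WeightedSpace w, ∀ u, e (f u) = WeightedSpace.ofBasis b w u := by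
  have := WeightedSpace.t2Space hw
  have := WeightedSpace.completeSpace hw
  refine hf.exists_continuousLinearEquiv (WeightedSpace.denseRange_ofBasis b)
    WeightedSpace.withSeminorms_sem h₁ fun p hp => ?_
  obtain ⟨i, C, hC⟩ := h₂ p hp
  exact ⟨C • WeightedSpace.sem w i, (WeightedSpace.continuous_sem i).const_smul C,
    le_basisSeminorm b (w i) hC⟩

/-! ### Normally ordered bases and the quantum plane -/

/-- The basis `b` multiplies like the normally ordered monomials `x^i y^j` of the quantum plane,
for which `y^j x^k = q^{-jk} x^k y^j`. -/
def IsNormalOrdered (q : ℂ) {B : Type*} [Ring B] [Algebra ℂ B] (b : Module.Basis (ℕ × ℕ) ℂ B) :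
    Prop :=
  ∀ m n, b m * b n = (q ^ (m.2 * n.1))⁻¹ • b (m + n)

namespace QuantumPlane

variable {q : ℂ}

theorem x_mul_y : x q * y q = q • (y q * x q) :=
  (map_mul _ _ _).symm.trans ((RingQuot.mkAlgHom_rel ℂ QuantumPlaneRel.rel).trans
    ((map_smul _ _ _).trans (congrArg (q • ·) (map_mul _ _ _))))

theorem y_mul_x_pow (hq : q ≠ 0) (k : ℕ) : y q * x q ^ k = (q ^ k)⁻¹ • (x q ^ k * y q) := by
  have h : y q * x q = q⁻¹ • (x q * y q) := by
    rw [x_mul_y, smul_smul, inv_mul_cancel₀ hq, one_smul]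
  induction k with
  | zero => simp
  | succ k ih =>
    rw [pow_succ, ← mul_assoc, ih, smul_mul_assoc, mul_assoc, h, mul_smul_comm, smul_smul,
      ← mul_assoc, pow_succ, mul_inv]

theorem y_pow_mul_x_pow (hq : q ≠ 0) (j k : ℕ) :
    y q ^ j * x q ^ k = (q ^ (j * k))⁻¹ • (x q ^ k * y q ^ j) := by
  induction j with
  | zero => simp
  | succ j ih =>
    rw [pow_succ', mul_assoc, ih, mul_smul_comm, ← mul_assoc, y_mul_x_pow hq, smul_mul_assoc,
      smul_smul, mul_assoc, ← mul_inv, ← pow_add, add_mul, one_mul]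

theorem algHom_ext {B : Type*} [Ring B] [Algebra ℂ B] {f g : QuantumPlane q →ₐ[ℂ] B}
    (hx : f (x q) = g (x q)) (hy : f (y q) = g (y q)) : f = g := by
  refine RingQuot.ringQuot_ext' _ _ _ (FreeAlgebra.hom_ext (funext fun i => ?_))
  fin_cases i
  exacts [hx, hy]

end QuantumPlane

namespace IsNormalOrdered

variable {q : ℂ} {B : Type*} [Ring B] [Algebra ℂ B] {b : Module.Basis (ℕ × ℕ) ℂ B}
  (hb : IsNormalOrdered q b)
include hb

theorem map {C : Type*} [Ring C] [Algebra ℂ C] (e : B ≃ₐ[ℂ] C) :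
    IsNormalOrdered q (b.map e.toLinearEquiv) := fun m n => by
  simp only [Module.Basis.map_apply, AlgEquiv.toLinearEquiv_apply, ← map_mul, hb m n, map_smul]

theorem basis_zero : b 0 = 1 := by
  have h : LinearMap.mulLeft ℂ (b 0) = LinearMap.id := b.ext fun n => by simpa using hb 0 n
  simpa using LinearMap.congr_fun h 1

theorem basis_fst_pow (i : ℕ) : b (1, 0) ^ i = b (i, 0) := by
  induction i with
  | zero => exact (pow_zero _).trans hb.basis_zero.symm
  | succ i ih => simp [pow_succ, ih, hb _ _]

theorem basis_snd_pow (j : ℕ) : b (0, 1) ^ j = b (0, j) := by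
  induction j with
  | zero => exact (pow_zero _).trans hb.basis_zero.symm
  | succ j ih => simp [pow_succ, ih, hb _ _]

theorem basis_pow_mul_pow (i j : ℕ) : b (1, 0) ^ i * b (0, 1) ^ j = b (i, j) := by
  simp [hb.basis_fst_pow, hb.basis_snd_pow, hb _ _]

theorem basis_eq_smul (hq : q ≠ 0) (i j : ℕ) :
    b (i, j) = q ^ (i * j) • (b (0, 1) ^ j * b (1, 0) ^ i) := by
  simp [hb.basis_fst_pow, hb.basis_snd_pow, hb _ _, mul_comm j i, smul_smul, hq]

/-- The homomorphism from the quantum plane that sends the generators to the corresponding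
monomials. -/
def ofQuantumPlane (hq : q ≠ 0) : QuantumPlane q →ₐ[ℂ] B :=
  RingQuot.liftAlgHom ℂ ⟨FreeAlgebra.lift ℂ ![b (1, 0), b (0, 1)], by
    rintro _ _ ⟨⟩
    simp [hb _ _, smul_smul, hq]⟩

theorem ofQuantumPlane_x (hq : q ≠ 0) : hb.ofQuantumPlane hq (QuantumPlane.x q) = b (1, 0) := by
  simp [ofQuantumPlane, QuantumPlane.x]

theorem ofQuantumPlane_y (hq : q ≠ 0) : hb.ofQuantumPlane hq (QuantumPlane.y q) = b (0, 1) := by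
  simp [ofQuantumPlane, QuantumPlane.y]

/-- The homomorphism to the quantum plane that sends the basis to the monomials `x^i y^j`. -/
def toQuantumPlane (hq : q ≠ 0) : B →ₐ[ℂ] QuantumPlane q :=
  AlgHom.ofLinearMap (b.constr ℂ fun n => QuantumPlane.x q ^ n.1 * QuantumPlane.y q ^ n.2)
    (by rw [← hb.basis_zero, b.constr_basis]; simp)
    (by
      rw [LinearMap.map_mul_iff]
      refine b.ext fun m => b.ext fun n => ?_
      simp only [LinearMap.compr₂_apply, LinearMap.mul_apply', LinearMap.compl₂_apply,
        LinearMap.comp_apply, hb m n, map_smul, b.constr_basis, Prod.fst_add, Prod.snd_add]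
      rw [mul_assoc, ← mul_assoc (QuantumPlane.y q ^ m.2), QuantumPlane.y_pow_mul_x_pow hq,
        smul_mul_assoc, mul_smul_comm, pow_add, pow_add]
      simp only [mul_assoc])

theorem toQuantumPlane_basis (hq : q ≠ 0) (n : ℕ × ℕ) :
    hb.toQuantumPlane hq (b n) = QuantumPlane.x q ^ n.1 * QuantumPlane.y q ^ n.2 :=
  b.constr_basis ℂ _ n

/-- An algebra with a normally ordered basis is the quantum plane. -/
def quantumPlaneEquiv (hq : q ≠ 0) : QuantumPlane q ≃ₐ[ℂ] B :=
  AlgEquiv.ofAlgHom (hb.ofQuantumPlane hq) (hb.toQuantumPlane hq)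
    (AlgHom.toLinearMap_injective (b.ext fun n => by
      simp [hb.toQuantumPlane_basis, hb.ofQuantumPlane_x, hb.ofQuantumPlane_y,
        hb.basis_pow_mul_pow]))
    (QuantumPlane.algHom_ext
      (by simpa [hb.ofQuantumPlane_x] using hb.toQuantumPlane_basis hq (1, 0))
      (by simpa [hb.ofQuantumPlane_y] using hb.toQuantumPlane_basis hq (0, 1)))

theorem quantumPlaneEquiv_x (hq : q ≠ 0) :
    hb.quantumPlaneEquiv hq (QuantumPlane.x q) = b (1, 0) :=
  hb.ofQuantumPlane_x hq

theorem quantumPlaneEquiv_y (hq : q ≠ 0) :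
    hb.quantumPlaneEquiv hq (QuantumPlane.y q) = b (0, 1) :=
  hb.ofQuantumPlane_y hq

theorem quantumPlaneEquiv_symm_basis (hq : q ≠ 0) (n : ℕ × ℕ) :
    (hb.quantumPlaneEquiv hq).symm (b n) = QuantumPlane.x q ^ n.1 * QuantumPlane.y q ^ n.2 :=
  hb.toQuantumPlane_basis hq n

theorem basisSeminorm_mul_le (hq : q ≠ 0) (hq1 : ‖q‖ ≤ 1) (ρ : {ρ : ℝ≥0 // 0 < ρ}) (m n : ℕ × ℕ) :
    basisSeminorm b (quantumWeight q ρ) (b m * b n) ≤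
      quantumWeight q ρ m * quantumWeight q ρ n := by
  have hq0 : 0 < ‖q‖ := norm_pos_iff.2 hq
  rw [hb m n, map_smul_eq_mul, basisSeminorm_basis, norm_inv, norm_pow,
    inv_mul_le_iff₀ (by positivity)]
  calc (quantumWeight q ρ (m + n) : ℝ)
      = ‖q‖ ^ (m.1 * n.2) * (‖q‖ ^ (m.2 * n.1) *
          (quantumWeight q ρ m * quantumWeight q ρ n)) := by
        simp only [quantumWeight, Prod.fst_add, Prod.snd_add]
        push_cast
        ring
    _ ≤ ‖q‖ ^ (m.2 * n.1) * (quantumWeight q ρ m * quantumWeight q ρ n) :=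
        mul_le_of_le_one_left (by positivity) (pow_le_one₀ hq0.le hq1)

theorem exists_le_quantumWeight (hq : q ≠ 0) {p : Seminorm ℂ B} (hp : p ∈ submulSeminorms B) :
    ∃ (ρ : {ρ : ℝ≥0 // 0 < ρ}) (C : ℝ≥0), ∀ n, p (b n) ≤ C * quantumWeight q ρ n := by
  let ρ : ℝ≥0 := max 1 (max (p (b (1, 0))).toNNReal (p (b (0, 1))).toNNReal)
  have hx : p (b (1, 0)) ≤ ρ := (Real.le_coe_toNNReal _).trans
    (NNReal.coe_le_coe.2 ((le_max_left _ _).trans (le_max_right _ _)))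
  have hy : p (b (0, 1)) ≤ ρ := (Real.le_coe_toNNReal _).trans
    (NNReal.coe_le_coe.2 ((le_max_right _ _).trans (le_max_right _ _)))
  refine ⟨⟨ρ, zero_lt_one.trans_le (le_max_left _ _)⟩, (p 1).toNNReal ^ 2, fun ⟨i, j⟩ => ?_⟩
  calc p (b (i, j))
      = ‖q‖ ^ (i * j) * p (b (0, 1) ^ j * b (1, 0) ^ i) := by
        rw [hb.basis_eq_smul hq, map_smul_eq_mul, norm_pow]
    _ ≤ ‖q‖ ^ (i * j) * ((p 1 * p (b (0, 1)) ^ j) * (p 1 * p (b (1, 0)) ^ i)) := by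
        gcongr
        exact (hp _ _).trans (mul_le_mul (submul_pow_le hp _ j) (submul_pow_le hp _ i)
          (apply_nonneg _ _) (by positivity))
    _ ≤ ‖q‖ ^ (i * j) * ((p 1 * ρ ^ j) * (p 1 * ρ ^ i)) := by gcongr
    _ = ↑((p 1).toNNReal ^ 2) * quantumWeight q ⟨ρ, _⟩ (i, j) := by
        simp only [quantumWeight, NNReal.coe_mul, NNReal.coe_pow, coe_nnnorm,
          Real.coe_toNNReal _ (apply_nonneg p 1)]
        ring

theorem exists_amEnvelope_equiv (hq : q ≠ 0) (hq1 : ‖q‖ ≤ 1) :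
    ∃ e : AMEnvelope B ≃L[ℂ] WeightedSpace (quantumWeight q),
      ∀ u, e (toAMEnvelope B u) = WeightedSpace.ofBasis b _ u := by
  have h_pos (n : ℕ × ℕ) : ∃ ρ, 0 < quantumWeight q ρ n :=
    ⟨⟨1, one_pos⟩, by simp [quantumWeight, hq]⟩
  refine (isSeminormCompletion_toAMEnvelope B).exists_equiv_weightedSpace b h_pos (fun ρ => ?_)
    fun p hp => hb.exists_le_quantumWeight hq hp
  exact ⟨_, basisSeminorm_mem_submulSeminorms b _ (hb.basisSeminorm_mul_le hq hq1 ρ),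
    fun u => le_rfl⟩

end IsNormalOrdered

/-! ### The smash product `ℂ[x] # ℂℤ₊` -/

theorem not_exists_hopfAlgebra {H : Type*} [Ring H] [B : Bialgebra ℂ H] {g : H}
    (hg : IsGroupLikeElem ℂ g) (hu : ¬ IsUnit g) :
    ¬ ∃ S : HopfAlgebra ℂ H, S.toHopfAlgebraStruct.toBialgebra = B := by
  rintro ⟨S, rfl⟩
  exact hu hg.isUnit

theorem ModuleAlgebra.smashTmul_mul_of_isGroupLikeElem {H A : Type*} [Ring H] [Bialgebra ℂ H]
    [Ring A] [Algebra ℂ A] (ρ : ModuleAlgebra H A) {h : H} (hh : IsGroupLikeElem ℂ h)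
    (a b : A) (k : H) :
    ρ.smashTmul a h * ρ.smashTmul b k = ρ.smashTmul (a * ρ.act h b) (h * k) := by
  refine (ρ.smashMul_tmul a b h k).trans ?_
  rw [hh.comul_eq_tmul_self, TensorProduct.map_tmul]
  rfl

theorem isGroupLikeElem_delta (k : ℕ) : IsGroupLikeElem ℂ (delta k) :=
  AddMonoidAlgebra.isGroupLikeElem_single_one k

theorem not_isUnit_delta_one : ¬ IsUnit (delta 1) := by
  intro h
  have := h.map (AddMonoidAlgebra.lift ℂ ℂ ℕ (powersHom ℂ 0))
  simp [delta, AddMonoidAlgebra.lift_single] at this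

theorem delta_mul (j k : ℕ) : delta j * delta k = delta (j + k) := by
  simp [delta, AddMonoidAlgebra.single_mul_single]

theorem delta_one_pow (j : ℕ) : delta 1 ^ j = delta j := by
  simp [delta, AddMonoidAlgebra.single_pow]

theorem basisMonomials_apply_eq_X_pow (n : ℕ) :
    Polynomial.basisMonomials ℂ n = (Polynomial.X ^ n : Polynomial ℂ) := by
  rw [Polynomial.coe_basisMonomials, Polynomial.X_pow_eq_monomial]

section

variable (q : ℂ)

theorem qAction_act_delta (k : ℕ) (f : Polynomial ℂ) : (qAction q).act (delta k) f =
    f.comp (Polynomial.C (q ^ k)⁻¹ * Polynomial.X) := by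
  simp [Polynomial.comp_eq_aeval, qAction, ModuleAlgebra.ofEndomorphisms, delta,
    AddMonoidAlgebra.lift_single]

theorem qAction_act_delta_X_pow (k n : ℕ) : (qAction q).act (delta k) (Polynomial.X ^ n) =
    (q ^ (k * n))⁻¹ • (Polynomial.X ^ n : Polynomial ℂ) := by
  rw [qAction_act_delta, Polynomial.X_pow_comp, mul_pow, ← Polynomial.C_pow,
    ← Polynomial.smul_eq_C_mul, inv_pow, pow_mul]

/-- The basis `x^i ⊗ δ_j` of `ℂ[x] # ℂℤ₊`. -/
def smashBasis : Module.Basis (ℕ × ℕ) ℂ (qAction q).Smash :=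
  (show Module.Basis (ℕ × ℕ) ℂ (Polynomial ℂ ⊗[ℂ] AddMonoidAlgebra ℂ ℕ) from
    (Polynomial.basisMonomials ℂ).tensorProduct (AddMonoidAlgebra.basis ℕ ℂ))

theorem smashBasis_apply (n : ℕ × ℕ) :
    smashBasis q n = (qAction q).smashTmul (Polynomial.X ^ n.1) (delta n.2) := by
  refine (Module.Basis.tensorProduct_apply _ _ n.1 n.2).trans ?_
  rw [basisMonomials_apply_eq_X_pow, AddMonoidAlgebra.basis_apply]
  rfl

theorem isNormalOrdered_smashBasis : IsNormalOrdered q (smashBasis q) := fun m n => by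
  rw [smashBasis_apply, smashBasis_apply, smashBasis_apply,
    (qAction q).smashTmul_mul_of_isGroupLikeElem (isGroupLikeElem_delta m.2),
    qAction_act_delta_X_pow, mul_smul_comm, ← pow_add, delta_mul]
  exact (TensorProduct.smul_tmul' _ _ _).symm

end

/-! ### Stable seminorms on `ℂ[x]` -/

theorem ModuleAlgebra.mem_stableSeminorms_of_span {H A : Type*} [Ring H] [Bialgebra ℂ H] [Ring A]
    [Algebra ℂ A] (ρ : ModuleAlgebra H A) {s : Set H} (hs : Submodule.span ℂ s = ⊤)
    {p : Seminorm ℂ A} (hp : p ∈ submulSeminorms A)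
    (h : ∀ g ∈ s, ∃ C : ℝ, ∀ a, p (ρ.act g a) ≤ C * p a) : p ∈ ρ.stableSeminorms := by
  suffices hbound : ∀ g : H, ∃ C : ℝ, ∀ a, p (ρ.act g a) ≤ C * p a by
    refine ⟨hp, fun g => ?_⟩
    obtain ⟨C, hC⟩ := hbound g
    exact ⟨max C 1, by positivity, fun a => (hC a).trans (by gcongr; exact le_max_left _ _)⟩
  intro g
  have hg : g ∈ Submodule.span ℂ s := hs ▸ Submodule.mem_top
  induction hg using Submodule.span_induction with
  | mem g hg => exact h g hg
  | zero => exact ⟨0, fun a => by simp⟩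
  | add g g' _ _ ih ih' =>
    obtain ⟨C, hC⟩ := ih
    obtain ⟨C', hC'⟩ := ih'
    refine ⟨C + C', fun a => ?_⟩
    rw [map_add, LinearMap.add_apply, add_mul]
    exact (map_add_le_add p _ _).trans (add_le_add (hC a) (hC' a))
  | smul c g _ ih =>
    obtain ⟨C, hC⟩ := ih
    refine ⟨‖c‖ * C, fun a => ?_⟩
    rw [map_smul, LinearMap.smul_apply, map_smul_eq_mul, mul_assoc]
    exact mul_le_mul_of_nonneg_left (hC a) (norm_nonneg c)

/-- The indicator weight of `{0, …, N}`. -/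
def truncWeight (N n : ℕ) : ℝ≥0 := if n ≤ N then 1 else 0

/-- The seminorm `∑_{n ≤ N} |c_n|` on `ℂ[x]`. These turn out to generate the `ℂℤ₊`-stable
topology. -/
def truncSeminorm (N : ℕ) : Seminorm ℂ (Polynomial ℂ) :=
  basisSeminorm (Polynomial.basisMonomials ℂ) (truncWeight N)

theorem truncSeminorm_X_pow (N n : ℕ) : truncSeminorm N (Polynomial.X ^ n) = truncWeight N n := by
  rw [← basisMonomials_apply_eq_X_pow, truncSeminorm, basisSeminorm_basis]

theorem le_truncSeminorm {p : Seminorm ℂ (Polynomial ℂ)} {N : ℕ} {C : ℝ}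
    (h : ∀ n, p (Polynomial.X ^ n) ≤ C * truncWeight N n) (f : Polynomial ℂ) :
    p f ≤ C * truncSeminorm N f :=
  le_basisSeminorm _ _ (fun n => basisMonomials_apply_eq_X_pow n ▸ h n) f

theorem norm_coeff_le_truncSeminorm (n : ℕ) (f : Polynomial ℂ) :
    ‖f.coeff n‖ ≤ truncSeminorm n f := by
  have := norm_repr_mul_le_basisSeminorm (Polynomial.basisMonomials ℂ) (truncWeight n) f n
  rwa [truncWeight, if_pos le_rfl, NNReal.coe_one, mul_one] at this

theorem truncSeminorm_le_sum (N : ℕ) (f : Polynomial ℂ) :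
    truncSeminorm N f ≤ ∑ n ∈ Finset.range (N + 1), ‖f.coeff n‖ := by
  calc truncSeminorm N f
      = ∑ n ∈ f.support, ‖f.coeff n‖ * truncWeight N n := basisSeminorm_apply _ _ f
    _ = ∑ n ∈ f.support with n ≤ N, ‖f.coeff n‖ := by
      simp [truncWeight, Finset.sum_filter, apply_ite NNReal.toReal]
    _ ≤ ∑ n ∈ Finset.range (N + 1), ‖f.coeff n‖ :=
      Finset.sum_le_sum_of_subset_of_nonneg
        (fun n hn => Finset.mem_range_succ_iff.2 (Finset.mem_filter.1 hn).2)
        fun _ _ _ => norm_nonneg _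

theorem truncSeminorm_mem_submulSeminorms (N : ℕ) :
    truncSeminorm N ∈ submulSeminorms (Polynomial ℂ) := by
  refine basisSeminorm_mem_submulSeminorms _ _ fun m n => ?_
  rw [basisMonomials_apply_eq_X_pow, basisMonomials_apply_eq_X_pow, ← pow_add]
  refine (truncSeminorm_X_pow N (m + n)).le.trans ?_
  simp only [truncWeight]
  norm_cast
  split_ifs <;> omega

theorem truncSeminorm_mem_stableSeminorms (q : ℂ) (N : ℕ) :
    truncSeminorm N ∈ (qAction q).stableSeminorms := by
  refine (qAction q).mem_stableSeminorms_of_span (AddMonoidAlgebra.basis ℕ ℂ).span_eq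
    (truncSeminorm_mem_submulSeminorms N) ?_
  rintro _ ⟨k, rfl⟩
  rw [AddMonoidAlgebra.basis_apply, ← delta]
  refine ⟨∑ n ∈ Finset.range (N + 1), ‖(q ^ (k * n))⁻¹‖,
    le_truncSeminorm (p := (truncSeminorm N).comp ((qAction q).act (delta k))) fun n => ?_⟩
  rw [Seminorm.comp_apply, qAction_act_delta_X_pow, map_smul_eq_mul, truncSeminorm_X_pow]
  by_cases hn : n ≤ N
  · gcongr
    exact Finset.single_le_sum (f := fun n => ‖(q ^ (k * n))⁻¹‖) (fun _ _ => norm_nonneg _)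
      (Finset.mem_range_succ_iff.2 hn)
  · simp [truncWeight, hn]

section

variable {q : ℂ} (hq : q ≠ 0) (hq1 : ‖q‖ < 1) {p : Seminorm ℂ (Polynomial ℂ)}
  (hp : p ∈ (qAction q).stableSeminorms)
include hq hq1 hp

theorem eventually_stable_X_pow_eq_zero : ∀ᶠ n in atTop, p (Polynomial.X ^ n) = 0 := by
  obtain ⟨C, -, hC⟩ := hp.2 (delta 1)
  have hlim : Tendsto (fun n => ‖q‖⁻¹ ^ n) atTop atTop :=
    tendsto_pow_atTop_atTop_of_one_lt ((one_lt_inv₀ (norm_pos_iff.2 hq)).2 hq1)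
  filter_upwards [hlim.eventually_gt_atTop C] with n hn
  have h := hC (Polynomial.X ^ n)
  rw [qAction_act_delta_X_pow, one_mul, map_smul_eq_mul, norm_inv, norm_pow, ← inv_pow] at h
  by_contra h0
  exact hn.not_ge (le_of_mul_le_mul_right h ((apply_nonneg p _).lt_of_ne' h0))

theorem exists_stable_le_truncWeight :
    ∃ (N : ℕ) (C : ℝ≥0), ∀ n, p (Polynomial.X ^ n) ≤ C * truncWeight N n := by
  obtain ⟨N, hN⟩ := eventually_atTop.1 (eventually_stable_X_pow_eq_zero hq hq1 hp)
  refine ⟨N, ∑ n ∈ Finset.range (N + 1), (p (Polynomial.X ^ n)).toNNReal, fun n => ?_⟩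
  by_cases hn : n ≤ N
  · rw [truncWeight, if_pos hn, NNReal.coe_one, mul_one]
    exact (Real.le_coe_toNNReal _).trans (NNReal.coe_le_coe.2 (Finset.single_le_sum
      (f := fun n => (p (Polynomial.X ^ n)).toNNReal) (fun _ _ => zero_le)
      (Finset.mem_range_succ_iff.2 hn)))
  · simp [hN n (by omega), truncWeight, hn]

end

/-! ### The completions -/

theorem powerSeries_withSeminorms :
    WithSeminorms fun n => (normSeminorm ℂ ℂ).comp (PowerSeries.coeff (R := ℂ) n) := by
  rw [SeminormFamily.withSeminorms_iff_nhds_eq_iInf]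
  refine le_antisymm (le_iInf fun n => ?_) ?_
  · rw [← map_le_iff_le_comap]
    exact Continuous.tendsto' (continuous_norm.comp
      (PowerSeries.WithPiTopology.continuous_coeff ℂ n)) 0 _ (by simp)
  · refine (PowerSeries.WithPiTopology.tendsto_iff_coeff_tendsto ℂ id _ 0).2 fun n => ?_
    rw [map_zero, tendsto_zero_iff_norm_tendsto_zero]
    exact tendsto_iff_comap.2 (iInf_le _ n)

theorem exists_hCompletion_equiv {q : ℂ} (hq : q ≠ 0) (hq1 : ‖q‖ < 1) :
    ∃ e : (qAction q).HCompletion ≃A[ℂ] PowerSeries ℂ,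
      ∀ f : Polynomial ℂ, e ((qAction q).toHCompletion f) = (f : PowerSeries ℂ) := by
  have : ContinuousConstSMul ℂ (PowerSeries ℂ) := ⟨fun c =>
    (continuous_const_mul (PowerSeries.C c)).congr fun f => (PowerSeries.smul_eq_C_mul f c).symm⟩
  have h_completion := (qAction q).isSeminormCompletion_toHCompletion
  let g : Polynomial ℂ →ₐ[ℂ] PowerSeries ℂ := Polynomial.coeToPowerSeries.algHom ℂ
  have hg (f : Polynomial ℂ) : g f = f := by
    simp [g, Polynomial.coeToPowerSeries.algHom_apply]
  have hg_dense : DenseRange g.toLinearMap := by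
    have : ⇑g.toLinearMap = Polynomial.toPowerSeries := funext hg
    rw [this]
    exact PowerSeries.WithPiTopology.denseRange_toPowerSeries ℂ
  obtain ⟨e, he⟩ : ∃ e : (qAction q).HCompletion ≃L[ℂ] PowerSeries ℂ,
      ∀ f, e ((qAction q).toHCompletion f) = g f := by
    refine h_completion.exists_continuousLinearEquiv hg_dense powerSeries_withSeminorms
      (fun n => ⟨_, truncSeminorm_mem_stableSeminorms q n, fun f => ?_⟩) fun p hp => ?_
    · simpa [hg] using norm_coeff_le_truncSeminorm n f
    · obtain ⟨N, C, hC⟩ := exists_stable_le_truncWeight hq hq1 hp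
      refine ⟨C • ∑ n ∈ Finset.range (N + 1),
        (normSeminorm ℂ ℂ).comp (PowerSeries.coeff (R := ℂ) n), ?_, fun f => ?_⟩
      · refine Continuous.const_smul ?_ C
        rw [FunLike.coe_sum, Finset.sum_fn]
        exact continuous_finsetSum _ fun n _ => powerSeries_withSeminorms.continuous_seminorm n
      · refine (le_truncSeminorm hC f).trans
          (mul_le_mul_of_nonneg_left ((truncSeminorm_le_sum N f).trans_eq ?_) C.2)
        simp [hg]
  obtain ⟨E, hE⟩ := exists_continuousAlgEquiv_of_denseRange h_completion.denseRange e he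
  exact ⟨E, fun f => (hE _).trans ((he f).trans (hg f))⟩

/-- The seminorm `∑ |c_j| ρ^j` on `ℂℤ₊`. -/
def expSeminorm (ρ : ℝ≥0) : Seminorm ℂ (AddMonoidAlgebra ℂ ℕ) :=
  basisSeminorm (AddMonoidAlgebra.basis ℕ ℂ) fun j => ρ ^ j

theorem expSeminorm_mem_submulSeminorms (ρ : ℝ≥0) :
    expSeminorm ρ ∈ submulSeminorms (AddMonoidAlgebra ℂ ℕ) := by
  refine basisSeminorm_mem_submulSeminorms _ _ fun m n => ?_
  have h : AddMonoidAlgebra.basis ℕ ℂ m * AddMonoidAlgebra.basis ℕ ℂ n =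
      AddMonoidAlgebra.basis ℕ ℂ (m + n) := by
    simpa only [AddMonoidAlgebra.basis_apply, delta] using delta_mul m n
  rw [h, basisSeminorm_basis, pow_add, NNReal.coe_mul]

section

variable {q : ℂ} (hq : q ≠ 0) (hq1 : ‖q‖ < 1)
include hq hq1

theorem exists_projSeminorm_le_formalEntireWeight {p : Seminorm ℂ (Polynomial ℂ)}
    (hp : p ∈ (qAction q).stableSeminorms) {p' : Seminorm ℂ (AddMonoidAlgebra ℂ ℕ)}
    (hp' : p' ∈ submulSeminorms (AddMonoidAlgebra ℂ ℕ)) :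
    ∃ (i : {ρ : ℝ≥0 // 0 < ρ} × ℕ) (C : ℝ≥0), ∀ n : ℕ × ℕ,
      projSeminorm p p' ((Polynomial.X ^ n.1) ⊗ₜ delta n.2) ≤ C * formalEntireWeight i n := by
  obtain ⟨N, C, hC⟩ := exists_stable_le_truncWeight hq hq1 hp
  let ρ : ℝ≥0 := max 1 (p' (delta 1)).toNNReal
  have hρ : p' (delta 1) ≤ ρ :=
    (Real.le_coe_toNNReal _).trans (NNReal.coe_le_coe.2 (le_max_right _ _))
  refine ⟨(⟨ρ, zero_lt_one.trans_le (le_max_left _ _)⟩, N), C * (p' 1).toNNReal, fun n => ?_⟩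
  calc projSeminorm p p' ((Polynomial.X ^ n.1) ⊗ₜ delta n.2)
      ≤ p (Polynomial.X ^ n.1) * p' (delta 1 ^ n.2) := by
        rw [delta_one_pow]
        exact projSeminorm_tmul_le p p' _ _
    _ ≤ (C * truncWeight N n.1) * (p' 1 * p' (delta 1) ^ n.2) :=
        mul_le_mul (hC _) (submul_pow_le hp' _ _) (apply_nonneg _ _) (by positivity)
    _ ≤ (C * truncWeight N n.1) * (p' 1 * ρ ^ n.2) := by gcongr
    _ = ↑(C * (p' 1).toNNReal) * formalEntireWeight (⟨ρ, _⟩, N) n := by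
        simp only [formalEntireWeight, truncWeight, NNReal.coe_mul,
          Real.coe_toNNReal _ (apply_nonneg p' 1)]
        split_ifs <;> push_cast <;> ring

theorem exists_analyticSmash_equiv :
    ∃ e : (qAction q).AnalyticSmash ≃L[ℂ] WeightedSpace formalEntireWeight,
      ∀ u, e ((qAction q).toAnalyticSmash u) = WeightedSpace.ofBasis (smashBasis q) _ u := by
  have h_pos (n : ℕ × ℕ) : ∃ i, 0 < formalEntireWeight i n :=
    ⟨(⟨1, one_pos⟩, n.1), by simp [formalEntireWeight]⟩
  refine (qAction q).isSeminormCompletion_toAnalyticSmash.exists_equiv_weightedSpace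
    (smashBasis q) h_pos (fun i => ?_) ?_
  · refine ⟨_, Set.mem_image2_of_mem (truncSeminorm_mem_stableSeminorms q i.2)
      (expSeminorm_mem_submulSeminorms i.1.1), fun u => ?_⟩
    have h_weight : formalEntireWeight i = fun n => truncWeight i.2 n.1 * i.1.1 ^ n.2 := by
      ext n
      simp [formalEntireWeight, truncWeight]
    rw [h_weight]
    exact basisSeminorm_tensorProduct_le_projSeminorm _ _ _ _ u
  · rintro _ ⟨p, hp, p', hp', rfl⟩
    simp only [smashBasis_apply]
    exact exists_projSeminorm_le_formalEntireWeight hq hq1 hp hp'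

theorem exists_formalEntireWeight_le_quantumWeight (i : {ρ : ℝ≥0 // 0 < ρ} × ℕ) :
    ∃ ρ, ∀ n, formalEntireWeight i n ≤ quantumWeight q ρ n := by
  have hq0 : 0 < ‖q‖₊ := nnnorm_pos.2 hq
  let ρ : ℝ≥0 := max 1 (i.1.1 * (‖q‖₊ ^ i.2)⁻¹)
  have h1 : 1 ≤ ρ := le_max_left _ _
  have h2 : i.1.1 ≤ ‖q‖₊ ^ i.2 * ρ := by
    calc i.1.1 = ‖q‖₊ ^ i.2 * (i.1.1 * (‖q‖₊ ^ i.2)⁻¹) := by field_simp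
      _ ≤ ‖q‖₊ ^ i.2 * ρ := by gcongr; exact le_max_right _ _
  refine ⟨⟨ρ, one_pos.trans_le h1⟩, fun n => ?_⟩
  simp only [formalEntireWeight, quantumWeight]
  split_ifs with hn
  · calc i.1.1 ^ n.2 ≤ (‖q‖₊ ^ i.2 * ρ) ^ n.2 := by gcongr
      _ = ‖q‖₊ ^ (i.2 * n.2) * ρ ^ n.2 := by rw [mul_pow, pow_mul]
      _ ≤ ‖q‖₊ ^ (n.1 * n.2) * ρ ^ (n.1 + n.2) :=
        mul_le_mul' (pow_le_pow_of_le_one zero_le (show ‖q‖₊ ≤ 1 from hq1.le) (by gcongr))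
          (pow_le_pow_right₀ h1 (by omega))
  · exact zero_le

end

/-- The formal series `∑ x^i`, witnessing that `Φ` is not onto. -/
def geometricSeries : WeightedSpace formalEntireWeight :=
  (⟨fun n => if n.2 = 0 then 1 else 0, fun i => by
    refine summable_of_hasFiniteSupport (((Set.finite_Iic i.2).prod
      (Set.finite_singleton 0)).subset fun n hn => ?_)
    simp only [formalEntireWeight, Function.mem_support] at hn
    split_ifs at hn with h1 h2 <;> simp_all⟩ : weightedSubmodule formalEntireWeight)

theorem coord_geometricSeries_fst (i : ℕ) : geometricSeries.coord (i, 0) = 1 := rfl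

theorem coord_ne_coord_geometricSeries {q : ℂ} (c : WeightedSpace (quantumWeight q)) :
    c.coord ≠ geometricSeries.coord := fun h => by
  have h_summable := (c.summable_norm_coord_mul ⟨1, one_pos⟩).comp_injective
    (i := fun i : ℕ => (i, 0)) fun a b h => (Prod.mk.inj h).1
  have h_one : Summable fun _ : ℕ => (1 : ℝ) :=
    h_summable.congr fun i => by simp [h, coord_geometricSeries_fst, quantumWeight]
  exact one_ne_zero ((summable_const_iff 1).1 h_one)

theorem exists_amEnvelope_continuousAlgHom_not_surjective {q : ℂ} (hq : q ≠ 0) (hq1 : ‖q‖ < 1) :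
    ∃ Φ : AMEnvelope (qAction q).Smash →A[ℂ] (qAction q).AnalyticSmash,
      (∀ u, Φ (toAMEnvelope (qAction q).Smash u) = (qAction q).toAnalyticSmash u) ∧
      ¬ Function.Surjective Φ := by
  let j := WeightedSpace.inclusion (exists_formalEntireWeight_le_quantumWeight hq hq1)
  obtain ⟨e, he⟩ := (isNormalOrdered_smashBasis q).exists_amEnvelope_equiv hq hq1.le
  obtain ⟨e', he'⟩ := exists_analyticSmash_equiv hq hq1
  let φ := e'.symm.toContinuousLinearMap ∘L j ∘L e.toContinuousLinearMap
  have hφ (u : (qAction q).Smash) :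
      φ (toAMEnvelope (qAction q).Smash u) = (qAction q).toAnalyticSmash u := by
    refine e'.symm_apply_eq.2 ?_
    exact ((congrArg j (he u)).trans (WeightedSpace.inclusion_ofBasis _ _ u)).trans (he' u).symm
  obtain ⟨Φ, hΦ⟩ := exists_continuousAlgHom_of_denseRange
    (isSeminormCompletion_toAMEnvelope (qAction q).Smash).denseRange φ hφ
  refine ⟨Φ, fun u => (hΦ _).trans (hφ u), fun hΦ_surj => ?_⟩
  obtain ⟨z, hz⟩ := hΦ_surj (e'.symm geometricSeries)
  have hjz : j (e z) = geometricSeries := e'.symm.injective ((hΦ z).symm.trans hz)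
  exact coord_ne_coord_geometricSeries (e z)
    ((WeightedSpace.coord_inclusion _ _).symm.trans (congrArg WeightedSpace.coord hjz))

end AMSmash

end

theorem mainTheorem2 (q : ℂ) (hq : q ≠ 0) :
    -- the semigroup bialgebra `ℂℤ₊` admits no antipode
    (¬ ∃ S : HopfAlgebra ℂ (AddMonoidAlgebra ℂ ℕ),
      S.toHopfAlgebraStruct.toBialgebra = AddMonoidAlgebra.instBialgebra ℂ ℂ ℕ) ∧
    -- the action is `(k • f)(x) = f(q⁻ᵏ x)`
    (∀ (k : ℕ) (f : Polynomial ℂ), (qAction q).act (delta k) f =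
      f.comp (Polynomial.C (q ^ k)⁻¹ * Polynomial.X)) ∧
    -- `A # H` is the quantum plane
    (∃ e : QuantumPlane q ≃ₐ[ℂ] (qAction q).Smash,
      e (QuantumPlane.x q) = (qAction q).smashTmul Polynomial.X 1 ∧
      e (QuantumPlane.y q) = (qAction q).smashTmul 1 (delta 1)) ∧
    (‖q‖ < 1 →
      -- `Ã` is `ℂ[[x]]` with the topology of coordinatewise convergence
      (∃ e : (qAction q).HCompletion ≃A[ℂ] PowerSeries ℂ,
        ∀ f : Polynomial ℂ, e ((qAction q).toHCompletion f) = (f : PowerSeries ℂ)) ∧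
      -- the locally convex space `Ã #̂ Ĥ`
      (∃ e : (qAction q).AnalyticSmash ≃L[ℂ] WeightedSpace formalEntireWeight,
        ∀ i j : ℕ, (e ((qAction q).toAnalyticSmash
          ((qAction q).smashTmul (Polynomial.X ^ i) (delta j)))).coord = Pi.single (i, j) 1) ∧
      -- the locally convex space underlying the Arens-Michael envelope of the quantum plane
      (∃ e : AMEnvelope (QuantumPlane q) ≃L[ℂ] WeightedSpace (quantumWeight q),
        ∀ i j : ℕ, (e (toAMEnvelope (QuantumPlane q)
          (QuantumPlane.x q ^ i * QuantumPlane.y q ^ j))).coord = Pi.single (i, j) 1) ∧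
      -- the canonical map `(A # H)^ → Ã #̂ Ĥ` exists, is unique, and is not onto
      (∃ Φ : AMEnvelope (qAction q).Smash →A[ℂ] (qAction q).AnalyticSmash,
        (∀ u, Φ (toAMEnvelope (qAction q).Smash u) = (qAction q).toAnalyticSmash u) ∧
        (∀ Ψ : AMEnvelope (qAction q).Smash →A[ℂ] (qAction q).AnalyticSmash,
          (∀ u, Ψ (toAMEnvelope (qAction q).Smash u) = (qAction q).toAnalyticSmash u) → Ψ = Φ) ∧
        ¬ Function.Surjective Φ) ∧
      -- the canonical map `A # H → Ã #̂ Ĥ` does not extend to a topological isomorphism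
      ¬ ∃ e : AMEnvelope (qAction q).Smash ≃A[ℂ] (qAction q).AnalyticSmash,
        ∀ u, e (toAMEnvelope (qAction q).Smash u) = (qAction q).toAnalyticSmash u) := by
  have hb := isNormalOrdered_smashBasis q
  have h_dense := (isSeminormCompletion_toAMEnvelope (qAction q).Smash).denseRange
  refine ⟨not_exists_hopfAlgebra (isGroupLikeElem_delta 1) not_isUnit_delta_one,
    qAction_act_delta q, ⟨hb.quantumPlaneEquiv hq, ?_, ?_⟩,
    fun hq1 => ⟨exists_hCompletion_equiv hq hq1, ?_, ?_, ?_⟩⟩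
  · rw [hb.quantumPlaneEquiv_x, smashBasis_apply, pow_one]
    rfl
  · rw [hb.quantumPlaneEquiv_y, smashBasis_apply, pow_zero]
  · obtain ⟨e, he⟩ := exists_analyticSmash_equiv hq hq1
    refine ⟨e, fun i j => ?_⟩
    rw [he, ← smashBasis_apply q (i, j), WeightedSpace.coord_ofBasis_basis]
  · obtain ⟨e, he⟩ :=
      (hb.map (hb.quantumPlaneEquiv hq).symm).exists_amEnvelope_equiv hq hq1.le
    refine ⟨e, fun i j => ?_⟩
    rw [he, ← hb.quantumPlaneEquiv_symm_basis hq (i, j)]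
    exact WeightedSpace.coord_ofBasis_basis _ (i, j)
  · obtain ⟨Φ, hΦ, h_not_surj⟩ := exists_amEnvelope_continuousAlgHom_not_surjective hq hq1
    have h_unique (Ψ : AMEnvelope (qAction q).Smash →A[ℂ] (qAction q).AnalyticSmash)
        (hΨ : ∀ u, Ψ (toAMEnvelope (qAction q).Smash u) = (qAction q).toAnalyticSmash u) : Ψ = Φ :=
      continuousAlgHom_ext_of_denseRange h_dense fun u => (hΨ u).trans (hΦ u).symm
    exact ⟨⟨Φ, hΦ, h_unique, h_not_surj⟩, fun ⟨e, he⟩ =>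
      h_not_surj (h_unique e.toContinuousAlgHom he ▸ e.surjective)⟩
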